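/- Let $\Bbbk$ be a field. Operads are $\Bbbk$-linear symmetric operads $\mathcal P=(\mathcal P(n))_{n\ge 0}$ (right $\mathbb S_n$-actions, identity $\mathbb 1\in\mathcal P(1)$, multilinear, unital, associative and equivariant compositions $\theta\circ(\theta_1,\dots,\theta_n)$). A *2-unitary operad* is a triple $(\mathcal P,\mathbb 1_0,\mathbb 1_2)$ in which $\mathbb 1_0$ is a basis of $\mathcal P(0)$ and $\mathbb 1_2\in\mathcal P(2)$ satisfies $\mathbb 1_2\circ(\mathbb 1_0,\mathbb 1)=\mathbb 1=\mathbb 1_2\circ(\mathbb 1,\mathbb 1_0)$; it is *2a-unitary* if moreover $\mathbb 1_2\circ(\mathbb 1_2,\mathbb 1)=\mathbb 1_2\circ(\mathbb 1,\mathbb 1_2)$. Morphisms are the operad morphisms that preserve $\mathbb 1_0$ and $\mathbb 1_2$. For a locally finite operad (all $\dim_\Bbbk\mathcal P(n)<\infty$) put $$\operatorname{GKdim}\mathcal P=\limsup_{n\to\infty}\,\log_n\Bigl(\sum_{i=0}^n\dim_\Bbbk\mathcal P(i)\Bigr).$$ An augmented algebra is a unital associative $\Bbbk$-algebra $A$ with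 an algebra morphism $A\to\Bbbk$, whose kernel is denoted $\bar A$; morphisms are the unital algebra morphisms compatible with the augmentations. For a finite-dimensional augmented algebra $A$, let $\mathcal D_A$ be the 2-unitary operad with $$\mathcal D_A(n)=\Bbbk\mathbb 1_n\oplus\bigoplus_{i=1}^n\bar A\,\delta^n_i,\qquad \mathbb 1_n*\sigma=\mathbb 1_n,\quad (a\,\delta^n_i)*\sigma=a\,\delta^n_{\sigma^{-1}(i)},$$ with identity $\mathbb 1_1$, units $\mathbb 1_0,\mathbb 1_2$, and multilinear composition determined as follows. Let $\theta\in\mathcal D_A(n)$ and let the arguments have arities $k_1,\dots,k_n$. Put $m=k_1+\dots+k_n$, and let $(i,j)$ be the $j$-th place of the $i$-th block of $\{1,\dots,m\}$. Then $$\mathbb 1_n\circ(\mathbb 1_{k_1},\dots,\mathbb 1_{k_n})=\mathbb 1_m,\qquad a\,\delta^n_i\circ(\mathbb 1_{k_1},\dots,\mathbb 1_{k_n})=\sum_{j=1}^{k_i}a\,\delta^m_{(i,j)};$$ if the $i$-th argument is $b\,\delta^{k_i}_j$ and every other argument $r$ is $\mathbb 1_{k_r}$, the result is $b\,\delta^m_{(i,j)}$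 for $\theta=\mathbb 1_n$, it is $ab\,\delta^m_{(i,j)}$ for $\theta=a\,\delta^n_i$, and it is $0$ for $\theta=a\,\delta^n_s$ with $s\ne i$; the result is $0$ whenever at least two arguments are of the form $b\,\delta^{k}_j$. A morphism $f:A\to A'$ induces the morphism $\mathcal D_A\to\mathcal D_{A'}$, $\mathbb 1_n\mapsto\mathbb 1_n$, $a\,\delta^n_i\mapsto f(a)\,\delta^n_i$. **Theorem.** Consider the categories (1) of finite-dimensional associative, not necessarily unital, $\Bbbk$-algebras; (1') of finite-dimensional augmented unital associative $\Bbbk$-algebras; (2) of locally finite 2-unitary operads of $\operatorname{GKdim}\le 2$; (3) of locally finite 2a-unitary operads of $\operatorname{GKdim}\le 2$. The functor $A\mapsto\bar A$ is an equivalence from (1') to (1). The functor $A\mapsto\mathcal D_A$ takes values in (3), and it is an equivalence from (1') to (2) and from (1') to (3). The inclusion of (3) into (2) is an equivalence. Moreover, every operad in (2) is 2a-unitary and is isomorphic, as a 2-unitary operad, to $\mathcal D_A$ for some finite-dimensional augmented algebra $A$; and for every finite-dimensional augmented algebra $A$ and all $n\ge 0$ one has $\dim_\Bbbk\mathcal D_A(n)=1+n\dim_\Bbbk\bar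 A<\infty$. -/

import Mathlib

open CategoryTheory Finset

universe u

/-! ## Blocks and block permutations -/

/-- The division of `{0, …, m-1}`, `m = k 0 + ⋯ + k (n-1)`, into `n` consecutive blocks of sizes
`k 0, …, k (n-1)`: the pair `⟨i, j⟩` goes to the `j`-th place of the `i`-th block, that is, to
`k 0 + ⋯ + k (i-1) + j`. -/
def blockEquiv {n m : ℕ} (k : Fin n → ℕ) (h : ∑ i, k i = m) : (Σ i, Fin (k i)) ≃ Fin m :=
  finSigmaFinEquiv.trans (finCongr h)

theorem sum_comp_symm {n m : ℕ} (k : Fin n → ℕ) (h : ∑ i, k i = m) (σ : Equiv.Perm (Fin n)) :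
    ∑ i, k (σ.symm i) = m := by
  rw [← h]; exact Equiv.sum_comp σ.symm k

/-- The block permutation `ϑ(σ, τ₁, …, τₙ)`. The sequence `(ϑ⁻¹(1), …, ϑ⁻¹(m))` is the concatenation
of the sequences `B (σ⁻¹(1)), …, B (σ⁻¹(n))`, where `B i` is the `i`-th block of `{1, …, m}`
rearranged as `(mᵢ + τᵢ⁻¹(1), …, mᵢ + τᵢ⁻¹(kᵢ))`. In other words `ϑ⁻¹` sends the `b`-th place of the
`a`-th block, for the block sizes `k (σ⁻¹ 1), …, k (σ⁻¹ n)`, to the `τ_{σ⁻¹ a}⁻¹(b)`-th place of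
block `σ⁻¹ a`, for the block sizes `k 1, …, k n`. -/
def blockPerm {n m : ℕ} (k : Fin n → ℕ) (h : ∑ i, k i = m) (σ : Equiv.Perm (Fin n))
    (τ : ∀ i, Equiv.Perm (Fin (k i))) : Equiv.Perm (Fin m) :=
  ((blockEquiv (fun a => k (σ.symm a)) (sum_comp_symm k h σ)).symm.trans
    ((Equiv.sigmaCongrLeft (β := fun i => Fin (k i)) σ.symm).trans
      ((Equiv.sigmaCongrRight fun i => (τ i).symm).trans (blockEquiv k h)))).symm

/-! ## Linear symmetric operads -/

/-- A `K`-linear symmetric operad, in the classical form: spaces of `n`-ary operations with a right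
action of the symmetric group, an identity and multilinear compositions
`P(n) × P(k₁) × ⋯ × P(kₙ) → P(k₁ + ⋯ + kₙ)` which are unital, associative and equivariant.
The target arity `m` of a composition comes with a proof of `k₁ + ⋯ + kₙ = m`. -/
structure LinOperad (K : Type u) [Field K] where
  /-- the `n`-ary operations -/
  obj : ℕ → Type u
  [addCommGroup : ∀ n, AddCommGroup (obj n)]
  [module : ∀ n, Module K (obj n)]
  /-- the identity -/
  one : obj 1
  /-- the composition `x ∘ (y₁, …, yₙ)` -/
  comp : ∀ {n m : ℕ} (k : Fin n → ℕ), ∑ i, k i = m →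
    (obj n →ₗ[K] MultilinearMap K (fun i => obj (k i)) (obj m))
  /-- the right action `x ∗ σ` of the symmetric group -/
  act : ∀ {n : ℕ}, Equiv.Perm (Fin n) → (obj n →ₗ[K] obj n)
  act_one : ∀ {n : ℕ} (x : obj n), act 1 x = x
  act_mul : ∀ {n : ℕ} (σ τ : Equiv.Perm (Fin n)) (x : obj n), act (σ * τ) x = act τ (act σ x)
  comp_one : ∀ {n : ℕ} (h : ∑ _i : Fin n, 1 = n) (x : obj n),
    comp (fun _ => 1) h x (fun _ => one) = x
  one_comp : ∀ {n : ℕ} (h : ∑ _i : Fin 1, n = n) (x : obj n),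
    comp (fun _ => n) h one (fun _ => x) = x
  /-- `x ∘ (y₁ ∘ (z₁₁, …), …, yₙ ∘ (zₙ₁, …)) = (x ∘ (y₁, …, yₙ)) ∘ (z₁₁, …, zₙ₁, …)` -/
  assoc : ∀ {n m N : ℕ} (k : Fin n → ℕ) (hk : ∑ i, k i = m) (l : ∀ i, Fin (k i) → ℕ)
    (L : Fin n → ℕ) (hl : ∀ i, ∑ j, l i j = L i) (hL : ∑ i, L i = N)
    (hN : ∑ p, l ((blockEquiv k hk).symm p).1 ((blockEquiv k hk).symm p).2 = N)
    (x : obj n) (y : ∀ i, obj (k i)) (z : ∀ i j, obj (l i j)),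
    comp L hL x (fun i => comp (l i) (hl i) (y i) (z i)) =
      comp (fun p => l ((blockEquiv k hk).symm p).1 ((blockEquiv k hk).symm p).2) hN
        (comp k hk x y) (fun p => z ((blockEquiv k hk).symm p).1 ((blockEquiv k hk).symm p).2)
  /-- `(x ∗ σ) ∘ (y₁ ∗ τ₁, …, yₙ ∗ τₙ) = (x ∘ (y_{σ⁻¹(1)}, …, y_{σ⁻¹(n)})) ∗ ϑ(σ, τ₁, …, τₙ)` -/
  equivariance : ∀ {n m : ℕ} (k : Fin n → ℕ) (h : ∑ i, k i = m) (σ : Equiv.Perm (Fin n))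
    (τ : ∀ i, Equiv.Perm (Fin (k i))) (x : obj n) (y : ∀ i, obj (k i)),
    comp k h (act σ x) (fun i => act (τ i) (y i)) =
      act (blockPerm k h σ τ)
        (comp (fun i => k (σ.symm i)) (sum_comp_symm k h σ) x (fun i => y (σ.symm i)))

attribute [instance] LinOperad.addCommGroup LinOperad.module

namespace LinOperad

variable {K : Type u} [Field K]

/-- The family `(x, y)` of two operations, of arities `a` and `b`. -/
def pair (P : LinOperad K) {a b : ℕ} (x : P.obj a) (y : P.obj b) :
    ∀ i : Fin 2, P.obj (![a, b] i)
  | 0 => x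
  | 1 => y

theorem sum_pair {a b m : ℕ} (h : a + b = m) : ∑ i : Fin 2, ![a, b] i = m := by
  simpa using h

/-- The composition `θ ∘ (x, y)` of a binary operation with two operations. -/
def comp₂ (P : LinOperad K) {a b m : ℕ} (h : a + b = m) (θ : P.obj 2) (x : P.obj a)
    (y : P.obj b) : P.obj m :=
  P.comp ![a, b] (sum_pair h) θ (P.pair x y)

/-- Morphisms of operads. -/
@[ext]
structure Hom (P Q : LinOperad K) where
  /-- the component in arity `n` -/
  map : ∀ n, P.obj n →ₗ[K] Q.obj n
  map_act : ∀ {n : ℕ} (σ : Equiv.Perm (Fin n)) (x : P.obj n), map n (P.act σ x) = Q.act σ (map n x)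
  map_one : map 1 P.one = Q.one
  map_comp : ∀ {n m : ℕ} (k : Fin n → ℕ) (h : ∑ i, k i = m) (x : P.obj n) (y : ∀ i, P.obj (k i)),
    map m (P.comp k h x y) = Q.comp k h (map n x) (fun i => map (k i) (y i))

/-- Every space of operations is finite dimensional. -/
def LocallyFinite (P : LinOperad K) : Prop :=
  ∀ n, Module.Finite K (P.obj n)

/-- The Gelfand-Kirillov dimension `limsup_n log_n (∑_{i ≤ n} dim P(i))` of a locally finite operad,
as an extended real number. -/
noncomputable def gkdim (P : LinOperad K) : EReal :=
  Filter.limsup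
    (fun n : ℕ =>
      ((Real.logb n (∑ i ∈ range (n + 1), (Module.finrank K (P.obj i) : ℝ)) : ℝ) : EReal))
    Filter.atTop

end LinOperad

/-! ## 2-unitary operads -/

/-- A 2-unitary operad `(P, 𝟙₀, 𝟙₂)`: `𝟙₀` is a basis of `P(0)`, and
`𝟙₂ ∘ (𝟙₀, 𝟙) = 𝟙 = 𝟙₂ ∘ (𝟙, 𝟙₀)`. -/
structure TwoUnitaryOperad (K : Type u) [Field K] extends LinOperad K where
  /-- the 0-unit -/
  unit₀ : obj 0
  unit₀_ne_zero : unit₀ ≠ 0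
  exists_smul_unit₀ : ∀ x : obj 0, ∃ c : K, x = c • unit₀
  /-- the 2-unit -/
  unit₂ : obj 2
  unit₂_left : toLinOperad.comp₂ (zero_add 1) unit₂ unit₀ one = one
  unit₂_right : toLinOperad.comp₂ (add_zero 1) unit₂ one unit₀ = one

namespace TwoUnitaryOperad

variable {K : Type u} [Field K]

/-- Morphisms of 2-unitary operads: morphisms of operads that preserve `𝟙₀` and `𝟙₂`. -/
@[ext]
structure Hom (P Q : TwoUnitaryOperad K) extends
    LinOperad.Hom P.toLinOperad Q.toLinOperad where
  map_unit₀ : map 0 P.unit₀ = Q.unit₀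
  map_unit₂ : map 2 P.unit₂ = Q.unit₂

instance : Category (TwoUnitaryOperad K) where
  Hom P Q := Hom P Q
  id P :=
    { map := fun _ => LinearMap.id
      map_act := fun _ _ => rfl
      map_one := rfl
      map_comp := fun _ _ _ _ => rfl
      map_unit₀ := rfl
      map_unit₂ := rfl }
  comp f g :=
    { map := fun n => (g.map n).comp (f.map n)
      map_act := fun σ x => by simp [f.map_act, g.map_act]
      map_one := by simp [f.map_one, g.map_one]
      map_comp := fun k h x y => by simp [f.map_comp, g.map_comp]
      map_unit₀ := by simp [f.map_unit₀, g.map_unit₀]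
      map_unit₂ := by simp [f.map_unit₂, g.map_unit₂] }

variable (K) in
/-- The 2-unitary operads that are locally finite and of GK-dimension at most `2`. -/
def gkdimLETwo : ObjectProperty (TwoUnitaryOperad K) :=
  fun P => P.LocallyFinite ∧ P.gkdim ≤ 2

variable (K) in
/-- The 2a-unitary operads: the 2-unit is associative, `𝟙₂ ∘ (𝟙₂, 𝟙) = 𝟙₂ ∘ (𝟙, 𝟙₂)`. -/
def isTwoA : ObjectProperty (TwoUnitaryOperad K) :=
  fun P => P.comp₂ (m := 3) rfl P.unit₂ P.unit₂ P.one = P.comp₂ (m := 3) rfl P.unit₂ P.one P.unit₂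

end TwoUnitaryOperad

/-! ## Finite dimensional algebras -/

/-- Finite dimensional associative `K`-algebras, not necessarily unital. -/
structure FinNonUnitalAlg (K : Type u) [Field K] where
  /-- the underlying space -/
  carrier : Type u
  [ring : NonUnitalRing carrier]
  [module : Module K carrier]
  [isScalarTower : IsScalarTower K carrier carrier]
  [smulCommClass : SMulCommClass K carrier carrier]
  [finite : Module.Finite K carrier]

namespace FinNonUnitalAlg

variable {K : Type u} [Field K]

attribute [instance] ring module isScalarTower smulCommClass finite

/-- Morphisms are the multiplicative `K`-linear maps. -/
instance : Category (FinNonUnitalAlg K) where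
  Hom A B := A.carrier →ₙₐ[K] B.carrier
  id A := NonUnitalAlgHom.id K A.carrier
  comp f g := g.comp f

end FinNonUnitalAlg

/-- Finite dimensional augmented unital associative `K`-algebras. -/
structure FinAugAlg (K : Type u) [Field K] where
  /-- the underlying space -/
  carrier : Type u
  [ring : Ring carrier]
  [algebra : Algebra K carrier]
  [finite : Module.Finite K carrier]
  /-- the augmentation -/
  aug : carrier →ₐ[K] K

namespace FinAugAlg

variable {K : Type u} [Field K]

attribute [instance] ring algebra finite

/-- Morphisms of augmented algebras: unital algebra morphisms compatible with the augmentations. -/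
@[ext]
structure Hom (A B : FinAugAlg K) where
  /-- the algebra morphism -/
  toAlgHom : A.carrier →ₐ[K] B.carrier
  aug_comp : B.aug.comp toAlgHom = A.aug

instance : Category (FinAugAlg K) where
  Hom A B := Hom A B
  id A := ⟨AlgHom.id K A.carrier, AlgHom.comp_id _⟩
  comp f g := ⟨g.toAlgHom.comp f.toAlgHom, by
    rw [← AlgHom.comp_assoc, g.aug_comp, f.aug_comp]⟩

/-- The augmentation ideal, the kernel of the augmentation, as a non-unital algebra. -/
def ideal (A : FinAugAlg K) : NonUnitalSubalgebra K A.carrier where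
  carrier := {a | A.aug a = 0}
  add_mem' ha hb := by
    simp only [Set.mem_ofPred_eq] at *
    rw [map_add, ha, hb, add_zero]
  zero_mem' := map_zero _
  mul_mem' ha hb := by
    simp only [Set.mem_ofPred_eq] at *
    rw [map_mul, ha, zero_mul]
  smul_mem' c a ha := by
    simp only [Set.mem_ofPred_eq] at *
    rw [map_smul, ha, smul_zero]

instance (A : FinAugAlg K) : Module.Finite K A.ideal :=
  inferInstanceAs (Module.Finite K A.ideal.toSubmodule)

theorem aug_toAlgHom {A B : FinAugAlg K} (f : A ⟶ B) (a : A.carrier) :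
    B.aug (f.toAlgHom a) = A.aug a :=
  DFunLike.congr_fun f.aug_comp a

/-- The restriction of a morphism of augmented algebras to the augmentation ideals. -/
def idealMap {A B : FinAugAlg K} (f : A ⟶ B) : A.ideal →ₙₐ[K] B.ideal where
  toFun a := ⟨f.toAlgHom a, (aug_toAlgHom f a).trans a.2⟩
  map_smul' c a := Subtype.ext (map_smul f.toAlgHom c (a : A.carrier))
  map_zero' := Subtype.ext (map_zero f.toAlgHom)
  map_add' a b := Subtype.ext (map_add f.toAlgHom (a : A.carrier) b)
  map_mul' a b := Subtype.ext (map_mul f.toAlgHom (a : A.carrier) b)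

variable (K) in
/-- The functor from augmented algebras to non-unital algebras that takes an augmented algebra to
its augmentation ideal. -/
def augIdeal : FinAugAlg K ⥤ FinNonUnitalAlg K where
  obj A := { carrier := A.ideal }
  map f := idealMap f

end FinAugAlg

/-! ## The operad of an augmented algebra -/

theorem blockEquiv_val {n m : ℕ} (k : Fin n → ℕ) (h : ∑ i, k i = m) (i : Fin n) (j : Fin (k i)) :
    (blockEquiv k h ⟨i, j⟩ : ℕ) = ∑ i', (if i' < i then k i' else 0) + j := by
  subst h
  have h1 : (blockEquiv k rfl ⟨i, j⟩ : ℕ) = (finSigmaFinEquiv (⟨i, j⟩ : Σ i, Fin (k i)) : ℕ) := rfl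
  rw [h1, finSigmaFinEquiv_apply]
  congr 1
  rw [← Finset.sum_filter]
  refine Finset.sum_bij (fun a _ => Fin.castLE i.2.le a) ?_ ?_ ?_ ?_
  · intro a _
    rw [mem_filter, Fin.lt_def]
    exact ⟨mem_univ _, a.2⟩
  · intro a _ b _ hab
    simpa [Fin.ext_iff] using hab
  · intro b hb
    simp only [mem_filter, mem_univ, true_and] at hb
    exact ⟨⟨b, hb⟩, mem_univ _, rfl⟩
  · intro a _
    rfl

theorem blockEquiv_lt {n m : ℕ} (k : Fin n → ℕ) (h : ∑ i, k i = m) {i i' : Fin n}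
    (j : Fin (k i)) (j' : Fin (k i')) (hi : i' < i) :
    blockEquiv k h ⟨i', j'⟩ < blockEquiv k h ⟨i, j⟩ := by
  rw [Fin.lt_def, blockEquiv_val, blockEquiv_val]
  have h1 : ∑ a, (if a < i' then k a else 0) + k i' ≤ ∑ a, (if a < i then k a else 0) := by
    have h2 : ∑ a, (if a < i' then k a else 0) + k i' =
        ∑ a, ((if a < i' then k a else 0) + if a = i' then k a else 0) := by
      rw [Finset.sum_add_distrib]; simp
    rw [h2]
    refine Finset.sum_le_sum fun a _ => ?_
    rcases lt_trichotomy a i' with h | h | h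
    · simp [h, h.ne, h.trans hi]
    · subst h; simp [hi]
    · simp [h.not_gt, h.ne']
  have := j'.2
  omega

/-- Consecutive blocks of consecutive blocks. -/
theorem blockEquiv_blockEquiv {n m N : ℕ} (k : Fin n → ℕ) (hk : ∑ i, k i = m)
    (l : ∀ i, Fin (k i) → ℕ) (L : Fin n → ℕ) (hl : ∀ i, ∑ j, l i j = L i) (hL : ∑ i, L i = N)
    (hN : ∑ p, l ((blockEquiv k hk).symm p).1 ((blockEquiv k hk).symm p).2 = N)
    (p : Fin m) (r : Fin (l ((blockEquiv k hk).symm p).1 ((blockEquiv k hk).symm p).2)) :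
    blockEquiv (fun p => l ((blockEquiv k hk).symm p).1 ((blockEquiv k hk).symm p).2) hN ⟨p, r⟩ =
      blockEquiv L hL ⟨((blockEquiv k hk).symm p).1,
        blockEquiv (l ((blockEquiv k hk).symm p).1) (hl _) ⟨((blockEquiv k hk).symm p).2, r⟩⟩ := by
  apply Fin.ext
  rw [blockEquiv_val, blockEquiv_val, blockEquiv_val, ← add_assoc]
  congr 1
  generalize r.val = r
  obtain ⟨s, hs⟩ : ∃ s, s = (blockEquiv k hk).symm p := ⟨_, rfl⟩
  have hp : p = blockEquiv k hk s := by rw [hs, Equiv.apply_symm_apply]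
  rw [← hs, ← Equiv.sum_comp (blockEquiv k hk), hp]
  obtain ⟨F, hF⟩ : ∃ F : (Σ i, Fin (k i)) → ℕ, F = fun s => l s.1 s.2 := ⟨_, rfl⟩
  have h1 : ∀ t : Σ i, Fin (k i), l ((blockEquiv k hk).symm (blockEquiv k hk t)).1
      ((blockEquiv k hk).symm (blockEquiv k hk t)).2 = l t.1 t.2 := by
    intro t
    have : F ((blockEquiv k hk).symm (blockEquiv k hk t)) = F t := by rw [Equiv.symm_apply_apply]
    subst hF
    exact this
  simp only [h1]
  obtain ⟨i, j⟩ := s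
  rw [Fintype.sum_sigma]
  have h2 : ∀ i', ∑ j', (if blockEquiv k hk ⟨i', j'⟩ < blockEquiv k hk ⟨i, j⟩ then l i' j' else 0) =
      (if i' < i then L i' else 0) +
        (if i' = i then (∑ j', if j' < j then l i j' else 0) else 0) := by
    intro i'
    rcases lt_trichotomy i' i with h | h | h
    · simp [h, h.ne, blockEquiv_lt k hk j _ h, hl]
    · subst h
      have : ∀ j', blockEquiv k hk ⟨i', j'⟩ < blockEquiv k hk ⟨i', j⟩ ↔ j' < j := by
        intro j'
        rw [Fin.lt_def, blockEquiv_val, blockEquiv_val, Fin.lt_def]; omega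
      simp [this]
    · simp [h.not_gt, h.ne', fun j' => (blockEquiv_lt k hk j' j h).not_gt]
  simp only [h2, Finset.sum_add_distrib]
  simp

theorem prod_erase_blockEquiv {M : Type*} [CommMonoid M] {n m : ℕ} (k : Fin n → ℕ)
    (hk : ∑ i, k i = m) (F : (Σ i, Fin (k i)) → M) (s : Σ i, Fin (k i)) :
    ∏ p ∈ univ.erase (blockEquiv k hk s), F ((blockEquiv k hk).symm p) =
      (∏ i' ∈ univ.erase s.1, ∏ j', F ⟨i', j'⟩) * ∏ j' ∈ univ.erase s.2, F ⟨s.1, j'⟩ := by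
  have h1 : ∏ p ∈ univ.erase (blockEquiv k hk s), F ((blockEquiv k hk).symm p) =
      ∏ t ∈ univ.erase s, F t := by
    refine Finset.prod_bij (fun p _ => (blockEquiv k hk).symm p) ?_ ?_ ?_ ?_
    · intro p hp
      rw [mem_erase] at hp ⊢
      exact ⟨fun h => hp.1 (by rw [← h, Equiv.apply_symm_apply]), mem_univ _⟩
    · intro p _ q _ h
      exact (blockEquiv k hk).symm.injective h
    · intro t ht
      rw [mem_erase] at ht
      exact ⟨blockEquiv k hk t, by simpa using ht.1, by simp⟩
    · intro p _
      rfl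
  obtain ⟨i, j⟩ := s
  have h2 : (univ.erase (⟨i, j⟩ : Σ i, Fin (k i))) =
      univ.sigma fun i' => univ.filter fun j' => (⟨i', j'⟩ : Σ i, Fin (k i)) ≠ ⟨i, j⟩ := by
    ext t; simp
  rw [h1, h2, Finset.prod_sigma, ← Finset.prod_erase_mul univ _ (mem_univ i)]
  congr 1
  · refine Finset.prod_congr rfl fun i' hi' => Finset.prod_congr ?_ fun _ _ => rfl
    ext j'
    have : i' ≠ i := (mem_erase.mp hi').1
    simp [this]
  · refine Finset.prod_congr ?_ fun _ _ => rfl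
    ext j'
    simp

namespace FinNonUnitalAlg

variable {K : Type u} [Field K] (B : FinNonUnitalAlg K)

/-- The space `K 𝟙ₙ ⊕ ⨁ᵢ B δ⁽ⁿ⁾ᵢ` of `n`-ary operations of the operad `D_B`: the pair `(c, b)`
stands for `c 𝟙ₙ + ∑ᵢ bᵢ δ⁽ⁿ⁾ᵢ`. -/
abbrev DObj (n : ℕ) : Type u := K × (Fin n → B.carrier)

variable {B} in
/-- The coordinate of the composition `x ∘ (y₁, …, yₙ)` at the `j`-th place of the `i`-th block,
`s = ⟨i, j⟩`. With `x = (c, a)` and `yᵢ = (dᵢ, bᵢ)` it is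
`(∏ᵣ dᵣ) aᵢ + (∏_{r ≠ i} dᵣ) (c bᵢⱼ + aᵢ bᵢⱼ)`. -/
def dCoord {n : ℕ} {k : Fin n → ℕ} (x : B.DObj n) (y : ∀ i, B.DObj (k i)) (s : Σ i, Fin (k i)) :
    B.carrier :=
  (∏ r, (y r).1) • x.2 s.1 +
    (∏ r ∈ univ.erase s.1, (y r).1) • (x.1 • (y s.1).2 s.2 + x.2 s.1 * (y s.1).2 s.2)

/-- The composition of the operad `D_B`. It is the multilinear map for which
`𝟙ₙ ∘ (𝟙, …, 𝟙) = 𝟙`, `𝟙ₙ ∘ (𝟙, …, b δⱼ, …, 𝟙) = b δ₍ᵢ,ⱼ₎` with `b δⱼ` in the `i`-th place,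
`a δᵢ ∘ (𝟙, …, 𝟙) = ∑ⱼ a δ₍ᵢ,ⱼ₎` and `a δᵢ ∘ (𝟙, …, b δⱼ, …, 𝟙) = ab δ₍ᵢ,ⱼ₎` with `b δⱼ` in the
`i`-th place, while all other compositions of such elements are `0`; here `(i, j)` is the `j`-th
place of the `i`-th block. -/
def dComp {n m : ℕ} (k : Fin n → ℕ) (h : ∑ i, k i = m) (x : B.DObj n) (y : ∀ i, B.DObj (k i)) :
    B.DObj m :=
  (x.1 * ∏ r, (y r).1, fun p => dCoord x y ((blockEquiv k h).symm p))

variable {B}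

/-- The element `c + bₚ` of the unitization of `B`. -/
def hat {n : ℕ} (x : B.DObj n) (p : Fin n) : Unitization K B.carrier :=
  Unitization.inl x.1 + (x.2 p : Unitization K B.carrier)

theorem hat_add {n : ℕ} (x x' : B.DObj n) (p : Fin n) : hat (x + x') p = hat x p + hat x' p := by
  ext <;> simp [hat]

theorem hat_smul {n : ℕ} (c : K) (x : B.DObj n) (p : Fin n) : hat (c • x) p = c • hat x p := by
  ext <;> simp [hat]

theorem dObj_ext {n : ℕ} {x y : B.DObj n} (h₁ : x.1 = y.1) (h₂ : ∀ p, hat x p = hat y p) :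
    x = y := by
  refine Prod.ext h₁ (funext fun p => ?_)
  have := h₂ p
  rw [hat, hat, h₁] at this
  exact Unitization.inr_injective (add_left_cancel this)

theorem hat_dComp {n m : ℕ} (k : Fin n → ℕ) (h : ∑ i, k i = m) (x : B.DObj n)
    (y : ∀ i, B.DObj (k i)) (s : Σ i, Fin (k i)) :
    hat (B.dComp k h x y) (blockEquiv k h s) =
      (∏ r ∈ univ.erase s.1, (y r).1) • (hat x s.1 * hat (y s.1) s.2) := by
  have h1 : ∏ r, (y r).1 = (y s.1).1 * ∏ r ∈ univ.erase s.1, (y r).1 :=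
    (Finset.mul_prod_erase univ (fun r => (y r).1) (mem_univ s.1)).symm
  have h2 : (B.dComp k h x y).2 (blockEquiv k h s) = dCoord x y s := by
    simp only [dComp, Equiv.symm_apply_apply]
  ext
  · simp [hat, dComp, h1]; ring
  · simp only [hat, h2, dCoord, h1]
    simp [smul_smul, smul_add, mul_comm, add_assoc, add_left_comm]

theorem prod_update_fst {n : ℕ} {k : Fin n → ℕ} (y : ∀ i, B.DObj (k i)) (a : Fin n)
    (v : B.DObj (k a)) (s : Finset (Fin n)) :
    ∏ r ∈ s, (Function.update y a v r).1 =
      (if a ∈ s then v.1 else 1) * ∏ r ∈ s.erase a, (y r).1 := by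
  have h1 : ∏ r ∈ s.erase a, (Function.update y a v r).1 = ∏ r ∈ s.erase a, (y r).1 :=
    Finset.prod_congr rfl fun r hr => by rw [Function.update_of_ne (mem_erase.mp hr).1]
  split_ifs with h
  · rw [← h1, ← Finset.mul_prod_erase s _ h, Function.update_self]
  · rw [← h1, Finset.erase_eq_of_notMem h, one_mul]

theorem hat_dComp_update {n m : ℕ} (k : Fin n → ℕ) (h : ∑ i, k i = m) (x : B.DObj n)
    (y : ∀ i, B.DObj (k i)) (a : Fin n) (v : B.DObj (k a)) (s : Σ i, Fin (k i)) :
    hat (B.dComp k h x (Function.update y a v)) (blockEquiv k h s) =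
      (∏ r ∈ (univ.erase s.1).erase a, (y r).1) •
        (if e : a = s.1 then hat x s.1 * hat v (e ▸ s.2) else v.1 • (hat x s.1 * hat (y s.1) s.2)) := by
  obtain ⟨i, j⟩ := s
  rw [hat_dComp, prod_update_fst]
  by_cases e : a = i
  · subst e
    simp
  · simp [e, Function.update_of_ne (Ne.symm e), smul_smul, mul_comm]

variable (B) in
/-- The composition of `D_B` as a multilinear map. -/
def dCompLin {n m : ℕ} (k : Fin n → ℕ) (h : ∑ i, k i = m) :
    B.DObj n →ₗ[K] MultilinearMap K (fun i => B.DObj (k i)) (B.DObj m) where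
  toFun x :=
    { toFun := fun y => B.dComp k h x y
      map_update_add' := by
        intro inst y a v w
        have hi : inst = instDecidableEqFin n := Subsingleton.elim _ _
        subst hi
        refine dObj_ext ?_ fun p => ?_
        · simp only [dComp, prod_update_fst, Prod.fst_add]
          simp; ring
        · obtain ⟨s, rfl⟩ := (blockEquiv k h).surjective p
          rw [hat_add]
          simp only [hat_dComp_update]
          split_ifs
          · rw [hat_add, mul_add, smul_add]
          · rw [Prod.fst_add, add_smul, smul_add]
      map_update_smul' := by
        intro inst y a c v
        have hi : inst = instDecidableEqFin n := Subsingleton.elim _ _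
        subst hi
        refine dObj_ext ?_ fun p => ?_
        · simp only [dComp, prod_update_fst, Prod.smul_fst]
          simp; ring
        · obtain ⟨s, rfl⟩ := (blockEquiv k h).surjective p
          rw [hat_smul]
          simp only [hat_dComp_update]
          split_ifs
          · rw [hat_smul, mul_smul_comm, smul_comm]
          · rw [Prod.smul_fst, smul_assoc, smul_comm] }
  map_add' x x' := by
    ext1 y
    refine dObj_ext (by simp [dComp, add_mul]) fun p => ?_
    obtain ⟨s, rfl⟩ := (blockEquiv k h).surjective p
    change hat (B.dComp k h (x + x') y) _ = hat (B.dComp k h x y + B.dComp k h x' y) _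
    rw [hat_add, hat_dComp, hat_dComp, hat_dComp, hat_add, add_mul, smul_add]
  map_smul' c x := by
    ext1 y
    refine dObj_ext (by simp [dComp, mul_assoc]) fun p => ?_
    obtain ⟨s, rfl⟩ := (blockEquiv k h).surjective p
    change hat (B.dComp k h (c • x) y) _ = hat (c • B.dComp k h x y) _
    rw [hat_smul, hat_dComp, hat_dComp, hat_smul, smul_mul_assoc, smul_comm]

theorem dAssoc {n m N : ℕ} (k : Fin n → ℕ) (hk : ∑ i, k i = m) (l : ∀ i, Fin (k i) → ℕ)
    (L : Fin n → ℕ) (hl : ∀ i, ∑ j, l i j = L i) (hL : ∑ i, L i = N)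
    (hN : ∑ p, l ((blockEquiv k hk).symm p).1 ((blockEquiv k hk).symm p).2 = N)
    (x : B.DObj n) (y : ∀ i, B.DObj (k i)) (z : ∀ i j, B.DObj (l i j)) :
    B.dComp L hL x (fun i => B.dComp (l i) (hl i) (y i) (z i)) =
      B.dComp (fun p => l ((blockEquiv k hk).symm p).1 ((blockEquiv k hk).symm p).2) hN
        (B.dComp k hk x y)
        (fun p => z ((blockEquiv k hk).symm p).1 ((blockEquiv k hk).symm p).2) := by
  refine dObj_ext ?_ fun q => ?_
  · simp only [dComp]
    rw [← Equiv.prod_comp (blockEquiv k hk)]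
    let F : (Σ i, Fin (k i)) → K := fun s => (z s.1 s.2).1
    have h1 : ∀ t : Σ i, Fin (k i), (z ((blockEquiv k hk).symm (blockEquiv k hk t)).1
        ((blockEquiv k hk).symm (blockEquiv k hk t)).2).1 = F t := fun t =>
      congrArg F ((blockEquiv k hk).symm_apply_apply t)
    simp only [h1, F]
    rw [Fintype.prod_sigma, Finset.prod_mul_distrib, mul_assoc]
  · obtain ⟨⟨p, r⟩, rfl⟩ := (blockEquiv
      (fun p => l ((blockEquiv k hk).symm p).1 ((blockEquiv k hk).symm p).2) hN).surjective q
    rw [hat_dComp, blockEquiv_blockEquiv k hk l L hl hL hN, hat_dComp, hat_dComp]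
    dsimp only
    have h2 := hat_dComp k hk x y ((blockEquiv k hk).symm p)
    rw [Equiv.apply_symm_apply] at h2
    have h3 := prod_erase_blockEquiv k hk (fun s => (z s.1 s.2).1) ((blockEquiv k hk).symm p)
    rw [Equiv.apply_symm_apply] at h3
    rw [h2, h3]
    simp only [dComp, Finset.prod_mul_distrib, smul_mul_assoc, mul_smul_comm, smul_smul, mul_assoc]
    congr 1
    ring

theorem dEquivariance {n m : ℕ} (k : Fin n → ℕ) (h : ∑ i, k i = m) (σ : Equiv.Perm (Fin n))
    (τ : ∀ i, Equiv.Perm (Fin (k i))) (x : B.DObj n) (y : ∀ i, B.DObj (k i)) :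
    B.dComp k h (x.1, x.2 ∘ σ) (fun i => ((y i).1, (y i).2 ∘ τ i)) =
      ((B.dComp (fun i => k (σ.symm i)) (sum_comp_symm k h σ) x (fun i => y (σ.symm i))).1,
        (B.dComp (fun i => k (σ.symm i)) (sum_comp_symm k h σ) x (fun i => y (σ.symm i))).2 ∘
          blockPerm k h σ τ) := by
  refine dObj_ext ?_ fun p => ?_
  · simp only [dComp]
    rw [Equiv.prod_comp σ.symm fun i => (y i).1]
  · obtain ⟨q, rfl⟩ := (blockPerm k h σ τ).symm.surjective p
    obtain ⟨⟨a, b⟩, rfl⟩ := (blockEquiv _ (sum_comp_symm k h σ)).surjective q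
    have h1 : ∀ (w : B.DObj m) (p : Fin m), hat (w.1, w.2 ∘ blockPerm k h σ τ) p =
      hat w (blockPerm k h σ τ p) := fun _ _ => rfl
    rw [h1, Equiv.apply_symm_apply, hat_dComp]
    have h2 : (blockPerm k h σ τ).symm (blockEquiv _ (sum_comp_symm k h σ) ⟨a, b⟩) =
        blockEquiv k h ⟨σ.symm a, (τ (σ.symm a)).symm b⟩ := by
      simp [blockPerm, Equiv.sigmaCongrLeft]
    rw [h2, hat_dComp]
    dsimp only
    congr 1
    · refine Finset.prod_bij (fun i _ => σ i) ?_ ?_ ?_ ?_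
      · intro i hi
        rw [mem_erase] at hi ⊢
        exact ⟨fun e => hi.1 (by rw [← e, Equiv.symm_apply_apply]), mem_univ _⟩
      · intro i _ j _ e
        exact σ.injective e
      · intro i hi
        rw [mem_erase] at hi
        exact ⟨σ.symm i, by simpa using hi.1, by simp⟩
      · intro i _
        rw [Equiv.symm_apply_apply]
    · simp [hat]

variable (B) in
/-- The 2-unitary operad `D_B`, with `𝟙ₙ = (1, 0)` and `a δᵢ ∗ σ = a δ_{σ⁻¹(i)}`. -/
def dOperad : TwoUnitaryOperad K where
  obj n := B.DObj n
  one := (1, 0)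
  comp k h := B.dCompLin k h
  act σ :=
    { toFun := fun x => (x.1, x.2 ∘ σ)
      map_add' := fun _ _ => rfl
      map_smul' := fun _ _ => rfl }
  act_one _ := rfl
  act_mul _ _ _ := rfl
  comp_one h x := by
    refine dObj_ext ?_ fun p => ?_
    · simp [dCompLin, dComp]
    · obtain ⟨s, rfl⟩ := (blockEquiv _ h).surjective p
      refine (hat_dComp _ h x _ s).trans ?_
      have : blockEquiv (fun _ => 1) h s = s.1 := by
        apply Fin.ext
        obtain ⟨i, j⟩ := s
        rw [blockEquiv_val, ← Finset.sum_filter]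
        simp [Finset.filter_gt_eq_Iio]
      rw [this]
      simp [hat]
  one_comp h x := by
    refine dObj_ext ?_ fun p => ?_
    · simp [dCompLin, dComp]
    · obtain ⟨s, rfl⟩ := (blockEquiv _ h).surjective p
      refine (hat_dComp _ h _ _ s).trans ?_
      have : blockEquiv (fun _ => _) h s = s.2 := by
        apply Fin.ext
        obtain ⟨i, j⟩ := s
        rw [blockEquiv_val]
        simp [Subsingleton.elim i 0]
      rw [this]
      simp [hat, Subsingleton.elim s.1 0]
  assoc := dAssoc
  equivariance := dEquivariance
  unit₀ := (1, 0)
  unit₀_ne_zero := fun h => one_ne_zero (congrArg Prod.fst h)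
  exists_smul_unit₀ x := ⟨x.1, Prod.ext (by simp) (Subsingleton.elim _ _)⟩
  unit₂ := (1, 0)
  unit₂_left := by
    refine dObj_ext ?_ fun p => ?_
    · simp [LinOperad.comp₂, dCompLin, dComp, LinOperad.pair]
    · obtain ⟨⟨i, j⟩, rfl⟩ := (blockEquiv _ (LinOperad.sum_pair (zero_add 1))).surjective p
      refine (hat_dComp _ _ _ _ _).trans ?_
      match i, j with
      | 0, j => exact j.elim0
      | 1, j =>
        simp [LinOperad.pair, hat, show univ.erase (1 : Fin 2) = {0} from rfl]
        exact Unitization.inr_zero K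
  unit₂_right := by
    refine dObj_ext ?_ fun p => ?_
    · simp [LinOperad.comp₂, dCompLin, dComp, LinOperad.pair]
    · obtain ⟨⟨i, j⟩, rfl⟩ := (blockEquiv _ (LinOperad.sum_pair (add_zero 1))).surjective p
      refine (hat_dComp _ _ _ _ _).trans ?_
      match i, j with
      | 0, j =>
        simp [LinOperad.pair, hat, show univ.erase (0 : Fin 2) = {1} from rfl]
        exact Unitization.inr_zero K
      | 1, j => exact j.elim0

/-- The linear map `c 𝟙ₙ + ∑ᵢ bᵢ δᵢ ↦ c 𝟙ₙ + ∑ᵢ f(bᵢ) δᵢ`. -/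
def dMapLin {B B' : FinNonUnitalAlg K} (f : B.carrier →ₙₐ[K] B'.carrier) (n : ℕ) :
    B.DObj n →ₗ[K] B'.DObj n where
  toFun x := (x.1, fun i => f (x.2 i))
  map_add' x y := Prod.ext rfl (funext fun i => map_add f (x.2 i) (y.2 i))
  map_smul' c x := Prod.ext rfl (funext fun i => map_smul f c (x.2 i))

theorem dMapLin_dComp {B B' : FinNonUnitalAlg K} (f : B.carrier →ₙₐ[K] B'.carrier) {n m : ℕ}
    (k : Fin n → ℕ) (h : ∑ i, k i = m) (x : B.DObj n) (y : ∀ i, B.DObj (k i)) :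
    dMapLin f m (B.dComp k h x y) =
      B'.dComp k h (dMapLin f n x) (fun i => dMapLin f (k i) (y i)) := by
  refine Prod.ext rfl (funext fun p => ?_)
  simp [dMapLin, dComp, dCoord]

theorem dMapLin_unit {B B' : FinNonUnitalAlg K} (f : B.carrier →ₙₐ[K] B'.carrier) (n : ℕ) :
    dMapLin f n (1, 0) = (1, 0) :=
  Prod.ext rfl (funext fun _ => map_zero f)

/-- The morphism `D_B → D_{B'}` induced by a morphism `B → B'`. -/
def dMap {B B' : FinNonUnitalAlg K} (f : B ⟶ B') : B.dOperad ⟶ B'.dOperad where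
  map n := dMapLin f n
  map_act _ _ := rfl
  map_one := dMapLin_unit f 1
  map_comp k h x y := dMapLin_dComp f k h x y
  map_unit₀ := dMapLin_unit f 0
  map_unit₂ := dMapLin_unit f 2

end FinNonUnitalAlg

/-- The functor that takes a finite dimensional augmented algebra `A`, with augmentation ideal `Ā`,
to the 2-unitary operad `D_A` whose `n`-ary operations are `K 𝟙ₙ ⊕ ⨁ᵢ Ā δ⁽ⁿ⁾ᵢ`. -/
def operadD (K : Type u) [Field K] : FinAugAlg K ⥤ TwoUnitaryOperad K :=
  FinAugAlg.augIdeal K ⋙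
    { obj := fun B => B.dOperad
      map := fun f => FinNonUnitalAlg.dMap f
      map_id := fun _ => rfl
      map_comp := fun _ _ => rfl }

/-! ## Units and restrictions in a 2-unitary operad -/

namespace LinOperad

variable {K : Type u} [Field K] (P : LinOperad K)

/-! Let `P` be a locally finite 2-unitary operad and `A = P(1)`, an algebra under composition.
Substituting `𝟙₀` in all inputs of `x` gives a scalar `ε(x)` (`aug`); substituting `𝟙₀` in all
inputs but the `i`-th gives a unary operation `xᵢ` (`res`). On `A` the map `ε` is an augmentation,
and `ε(xᵢ) = ε(x)`. By associativity and multilinearity, restricting a composition to the `j`-th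
place of the `i`-th block leaves the product of `xᵢ` with the `j`-th restriction of `yᵢ`, times the
scalars `ε(yᵣ)` of the other blocks (`res_comp`). This is exactly the composition law of `D_A`, so
`x ↦ ε(x) 𝟙ₙ + ∑ᵢ (xᵢ - ε(x)) δᵢ` is a morphism `P → D_A` (`toD`). It is surjective because the
operations `𝟙ₙ` and `𝟙ₙ ∘ (𝟙, …, b, …, 𝟙)` have prescribed restrictions (`exists_aug_res`).

Injectivity comes from the growth bound. A nonzero operation of positive arity whose restrictions
all vanish produces a nonzero operation `x` of some arity `k ≥ 2` which dies under the substitution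
of `𝟙₀` in any nonempty set of inputs (`eq_zero_of_res`). Placing the inputs of `x` on any
`k`-element subset of `n` inputs, by means of `𝟙₂ ∘ (x, 𝟙ₙ₋ₖ)` and a permutation, gives `n.choose k`
linearly independent operations (`choose_le_finrank`). Partial sums of these binomial coefficients
grow like `n ^ (k + 1)`, so the GK-dimension is at least `3` (`IsCore.eq_zero`). Hence `P ≅ D_A`
when the GK-dimension is at most `2`, and since `𝟙₂` is associative in `D_A`, it is associative in
`P`.

Conversely `dim D_A(n)` is linear in `n`, so its partial sums are quadratic. Morphisms commute with
`ε` and the restrictions, so a morphism `D_B → D_{B'}` amounts to an algebra morphism `B → B'` read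
off in arity one. Together with the unitization, which inverts `A ↦ Ā`, this gives all the
equivalences. -/

theorem comp_congr {n m : ℕ} {k k' : Fin n → ℕ} (e : k = k') (h : ∑ i, k i = m)
    (h' : ∑ i, k' i = m) (x : P.obj n) (y : ∀ a, P.obj a) :
    P.comp k h x (fun i => y (k i)) = P.comp k' h' x (fun i => y (k' i)) := by
  subst e; rfl

theorem comp_zero_arity {m : ℕ} (k : Fin 0 → ℕ) (h : ∑ i, k i = m) (x : P.obj 0)
    (y : ∀ i, P.obj (k i)) (hm : m = 0) : P.comp k h x y = hm ▸ x := by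
  subst hm
  obtain rfl : k = fun _ => 1 := Subsingleton.elim _ _
  obtain rfl : y = fun _ => P.one := Subsingleton.elim _ _
  exact P.comp_one h x

end LinOperad

namespace TwoUnitaryOperad

variable {K : Type u} [Field K] (P : TwoUnitaryOperad K)

/-- The operation `𝟙ₙ`, the left bracketed product of `n` inputs. -/
def nUnit : ∀ n, P.obj n
  | 0 => P.unit₀
  | 1 => P.one
  | n + 2 => P.comp₂ (a := n + 1) rfl P.unit₂ (nUnit (n + 1)) P.one

/-- The operation `x ∘ (𝟙_{k₁}, …, 𝟙_{kₙ})`. -/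
def plug {n m : ℕ} (k : Fin n → ℕ) (h : ∑ i, k i = m) : P.obj n →ₗ[K] P.obj m where
  toFun x := P.comp k h x fun i => P.nUnit (k i)
  map_add' x y := by simp
  map_smul' c x := by simp

variable {P}

theorem plug_apply {n m : ℕ} (k : Fin n → ℕ) (h : ∑ i, k i = m) (x : P.obj n) :
    P.plug k h x = P.comp k h x fun i => P.nUnit (k i) := rfl

theorem plug_congr {n m : ℕ} {k k' : Fin n → ℕ} (e : k = k') (h : ∑ i, k i = m)
    (h' : ∑ i, k' i = m) (x : P.obj n) : P.plug k h x = P.plug k' h' x := by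
  subst e; rfl

theorem plug_one {n : ℕ} (k : Fin n → ℕ) (hk : ∀ i, k i = 1) (h : ∑ i, k i = n) (x : P.obj n) :
    P.plug k h x = x := by
  obtain rfl : k = fun _ => 1 := funext hk
  exact P.comp_one h x

/-- Associativity with the inner arities `l` indexed by all `m` places instead of by blocks. Drawing
the inner operations from a family `z` indexed by the arity alone lets `l` be rewritten without
transporting the operations. -/
theorem comp_comp_nUnit {n m N : ℕ} (k : Fin n → ℕ) (hk : ∑ i, k i = m) (l : Fin m → ℕ)
    (hl : ∑ p, l p = N) (L : Fin n → ℕ) (hL : ∑ i, L i = N)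
    (h : ∀ i, ∑ j, l (blockEquiv k hk ⟨i, j⟩) = L i) (x : P.obj n) (y : ∀ i, P.obj (k i))
    (z : ∀ a, P.obj a) :
    P.comp l hl (P.comp k hk x y) (fun p => z (l p)) =
      P.comp L hL x fun i => P.comp (fun j => l (blockEquiv k hk ⟨i, j⟩)) (h i) (y i)
        (fun j => z (l (blockEquiv k hk ⟨i, j⟩))) := by
  have e : (fun p => l (blockEquiv k hk
      ⟨((blockEquiv k hk).symm p).1, ((blockEquiv k hk).symm p).2⟩)) = l :=
    funext fun p => congrArg l ((blockEquiv k hk).apply_symm_apply p)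
  rw [P.assoc k hk (fun i j => l (blockEquiv k hk ⟨i, j⟩)) L h hL (by rw [e, hl])]
  exact (P.comp_congr e _ hl _ z).symm

theorem plug_comp {n m N : ℕ} (k : Fin n → ℕ) (hk : ∑ i, k i = m) (l : Fin m → ℕ)
    (hl : ∑ p, l p = N) (L : Fin n → ℕ) (hL : ∑ i, L i = N)
    (h : ∀ i, ∑ j, l (blockEquiv k hk ⟨i, j⟩) = L i) (x : P.obj n) (y : ∀ i, P.obj (k i)) :
    P.plug l hl (P.comp k hk x y) =
      P.comp L hL x fun i => P.plug (fun j => l (blockEquiv k hk ⟨i, j⟩)) (h i) (y i) :=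
  comp_comp_nUnit k hk l hl L hL h x y P.nUnit

/-- The bound on `n` matters: `𝟙₂` is not assumed associative, so already `𝟙₂ ∘ (𝟙, 𝟙₂)` need not be
the left bracketed `𝟙₃`. -/
theorem plug_nUnit {n m : ℕ} (hn : n ≤ 1) (k : Fin n → ℕ) (h : ∑ i, k i = m) :
    P.plug k h (P.nUnit n) = P.nUnit m := by
  match n, hn with
  | 0, _ =>
    obtain rfl : m = 0 := by simpa using h.symm
    exact P.comp_zero_arity k h _ _ rfl
  | 1, _ =>
    obtain rfl : k = fun _ => m := funext fun i => by
      rw [Subsingleton.elim i 0]; simpa using h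
    exact P.one_comp h _

theorem sum_block {n m : ℕ} (k : Fin n → ℕ) (hk : ∑ i, k i = m) (l : Fin m → ℕ) :
    ∑ i, ∑ j, l (blockEquiv k hk ⟨i, j⟩) = ∑ p, l p := by
  rw [← Equiv.sum_comp (blockEquiv k hk), Fintype.sum_sigma]

/-- Substitution of a unit in the second input of the 2-unit. -/
theorem comp₂_unit₀_right {n : ℕ} (x : P.obj n) :
    P.comp₂ (add_zero n) P.unit₂ x P.unit₀ = x := by
  have h := P.unit₂_right
  have h1 := P.one_comp (by simp) x
  rw [← h] at h1
  have hl : ∀ i, ∑ _j : Fin (![1, 0] i), n = ![n, 0] i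
    | 0 => Fin.sum_univ_one _
    | 1 => Fin.sum_univ_zero _
  -- Compose `𝟙₂ ∘ (𝟙, 𝟙₀) = 𝟙` with `x` and reassociate: `x` enters the first block, while the
  -- second block has no place to receive it.
  have h2 := P.assoc ![1, 0] (LinOperad.sum_pair (add_zero 1)) (fun _ _ => n) ![n, 0]
    hl (N := n) (by simp) (by simp) P.unit₂ (P.pair P.one P.unit₀) (fun _ _ => x)
  rw [LinOperad.comp₂] at h1
  rw [← h2] at h1
  refine Eq.trans ?_ h1
  rw [LinOperad.comp₂]
  congr 1
  funext i
  match i with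
  | 0 => exact (P.one_comp (by simp) x).symm
  | 1 => exact (P.comp_zero_arity _ _ _ _ rfl).symm

/-! ### The augmentation -/

variable (P) in
/-- The coordinate of a `0`-ary operation. -/
noncomputable def coord : P.obj 0 ≃ₗ[K] K :=
  (LinearEquiv.ofBijective (LinearMap.toSpanSingleton K (P.obj 0) P.unit₀)
    ⟨smul_left_injective K P.unit₀_ne_zero, fun x => by
      obtain ⟨c, rfl⟩ := P.exists_smul_unit₀ x
      exact ⟨c, rfl⟩⟩).symm

theorem coord_symm_apply (c : K) : P.coord.symm c = c • P.unit₀ := rfl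

variable (P) in
/-- The coordinate of `x ∘ (𝟙₀, …, 𝟙₀)`. -/
noncomputable def aug (n : ℕ) : P.obj n →ₗ[K] K :=
  P.coord.toLinearMap.comp (P.plug (fun _ => 0) (by simp))

theorem plug_zero {n : ℕ} (k : Fin n → ℕ) (hk : ∀ i, k i = 0) (h : ∑ i, k i = 0) (x : P.obj n) :
    P.plug k h x = P.aug n x • P.unit₀ := by
  rw [← coord_symm_apply, LinearEquiv.eq_symm_apply]
  exact congrArg P.coord (plug_congr (funext hk) _ _ x)

theorem aug_eq_of_plug {n : ℕ} {x : P.obj n} {c : K}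
    (h : P.plug (fun _ => 0) (by simp) x = c • P.unit₀) : P.aug n x = c := by
  rw [aug, LinearMap.comp_apply, h, ← coord_symm_apply]
  exact P.coord.apply_symm_apply c

/-- Filling every input with `𝟙₀` turns each `yᵢ` into `ε(yᵢ) 𝟙₀`; the scalars come out by
multilinearity and `x ∘ (𝟙₀, …, 𝟙₀)` remains. -/
theorem aug_comp {n m : ℕ} (k : Fin n → ℕ) (hk : ∑ i, k i = m) (x : P.obj n)
    (y : ∀ i, P.obj (k i)) : P.aug m (P.comp k hk x y) = P.aug n x * ∏ i, P.aug (k i) (y i) := by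
  apply aug_eq_of_plug
  rw [plug_comp k hk (fun _ => 0) _ (fun _ => 0) (by simp) (by simp)]
  have : (fun i => P.plug (fun _ : Fin (k i) => 0) (by simp) (y i)) =
      fun i => P.aug (k i) (y i) • P.unit₀ := funext fun i => plug_zero _ (fun _ => rfl) _ _
  rw [this, MultilinearMap.map_smul_univ, mul_comm, mul_smul,
    ← plug_zero (fun _ : Fin n => 0) (fun _ => rfl) (by simp)]
  rfl

theorem aug_unit₀ : P.aug 0 P.unit₀ = 1 :=
  aug_eq_of_plug <| by
    rw [one_smul]; exact plug_nUnit (n := 0) (by simp) _ _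

theorem aug_one : P.aug 1 P.one = 1 :=
  aug_eq_of_plug <| by
    rw [one_smul]; exact plug_nUnit (n := 1) le_rfl _ _

theorem aug_unit₂ : P.aug 2 P.unit₂ = 1 := by
  have h := congrArg (P.aug 1) P.unit₂_right
  rw [LinOperad.comp₂, aug_comp, Fin.prod_univ_two] at h
  have h0 : P.aug (![1, 0] 0) (P.pair P.one P.unit₀ 0) = 1 := aug_one
  have h1 : P.aug (![1, 0] 1) (P.pair P.one P.unit₀ 1) = 1 := aug_unit₀
  rwa [h0, h1, aug_one, mul_one, mul_one] at h

theorem aug_comp₂ {a b m : ℕ} (h : a + b = m) (t : P.obj 2) (x : P.obj a) (y : P.obj b) :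
    P.aug m (P.comp₂ h t x y) = P.aug 2 t * (P.aug a x * P.aug b y) := by
  rw [LinOperad.comp₂, aug_comp, Fin.prod_univ_two]
  rfl

theorem aug_nUnit : ∀ n, P.aug n (P.nUnit n) = 1
  | 0 => aug_unit₀
  | 1 => aug_one
  | n + 2 => by rw [nUnit, aug_comp₂, aug_nUnit (n + 1), aug_one, aug_unit₂]; simp

/-! ### The algebra of unary operations -/

variable (P) in
/-- The space of unary operations. -/
def Unary : Type u := P.obj 1

namespace Unary

instance : AddCommGroup P.Unary := inferInstanceAs (AddCommGroup (P.obj 1))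
instance : Module K P.Unary := inferInstanceAs (Module K (P.obj 1))

variable (P) in
/-- The composition of unary operations as a bilinear map. -/
def mulLin : P.Unary →ₗ[K] P.Unary →ₗ[K] P.Unary where
  toFun a := (MultilinearMap.ofSubsingleton K (P.obj 1) (P.obj 1) (0 : Fin 1)).symm
    (P.comp (n := 1) (m := 1) (fun _ => 1) (by simp) a)
  map_add' a b := LinearMap.ext fun c =>
    congrArg (fun f => f fun _ => c) (map_add (P.comp (n := 1) (m := 1) (fun _ => 1) (by simp)) a b)
  map_smul' r a := LinearMap.ext fun c =>
    congrArg (fun f => f fun _ => c) (map_smul (P.comp (n := 1) (m := 1) (fun _ => 1) (by simp)) r a)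

instance : Mul P.Unary := ⟨fun a b => mulLin P a b⟩
instance : One P.Unary := ⟨P.one⟩

instance : Ring P.Unary :=
  { (inferInstance : AddCommGroup P.Unary) with
    mul_assoc a b c := (P.assoc (fun _ : Fin 1 => 1) (by simp) (fun _ _ => 1) (fun _ => 1)
      (by simp) (by simp) (by simp) a (fun _ => b) (fun _ _ => c)).symm
    one_mul a := P.one_comp _ a
    mul_one a := P.comp_one _ a
    left_distrib a b c := map_add (mulLin P a) b c
    right_distrib a b c := congrArg (fun f => f c) (map_add (mulLin P) a b)
    zero_mul a := congrArg (fun f => f a) (map_zero (mulLin P))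
    mul_zero a := map_zero (mulLin P a) }

instance : Algebra K P.Unary := Algebra.ofModule
  (fun r a b => congrArg (fun f => f b) (map_smul (mulLin P) r a))
  (fun r a b => map_smul (mulLin P a) r b)

variable (P) in
/-- The augmentation of the algebra of unary operations. -/
noncomputable def augHom : P.Unary →ₐ[K] K :=
  AlgHom.ofLinearMap (P.aug 1) aug_one fun a b => (aug_comp _ _ _ _).trans (by simp; rfl)

end Unary

variable (P) in
/-- The augmented algebra of unary operations. -/
noncomputable abbrev unaryAlg (h : P.LocallyFinite) : FinAugAlg K where
  carrier := P.Unary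
  finite := h 1
  aug := Unary.augHom P

/-! ### The restrictions to one input -/

variable (P) in
/-- The unary operation `x ∘ (𝟙₀, …, 𝟙, …, 𝟙₀)` with `𝟙` in the `i`-th place. -/
def res {n : ℕ} (i : Fin n) : P.obj n →ₗ[K] P.Unary :=
  P.plug (m := 1) (fun r => if r = i then 1 else 0) (by simp)

/-- Puts the product in the form of a composition of `x` with operations of arities `0, …, 1, …, 0`,
so that in `res_comp` both sides can be compared argument by argument. -/
theorem res_mul {n : ℕ} (i : Fin n) (x : P.obj n) (a : P.Unary) :
    P.res i x * a = P.comp (m := 1) (fun r => if r = i then 1 else 0) (by simp) x fun r =>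
      P.comp (fun _ => 1) (by simp) (P.nUnit (if r = i then 1 else 0)) (fun _ => a) :=
  (P.assoc (fun r => if r = i then 1 else 0) (by simp) (fun _ _ => 1)
    (fun r => if r = i then 1 else 0) (by simp) (by simp) (by simp) x
    (fun r => P.nUnit (if r = i then 1 else 0)) (fun _ _ => a)).symm

/-- A block `r` other than `s.1` receives only `𝟙₀` and collapses to the scalar `ε(yᵣ)`; the block
`s.1` collapses to a restriction of its operation. This is the counterpart of
`FinNonUnitalAlg.hat_dComp`. -/
theorem res_comp {n m : ℕ} (k : Fin n → ℕ) (hk : ∑ i, k i = m) (x : P.obj n)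
    (y : ∀ i, P.obj (k i)) (s : Σ i, Fin (k i)) :
    P.res (blockEquiv k hk s) (P.comp k hk x y) =
      (∏ r ∈ univ.erase s.1, P.aug (k r) (y r)) • (P.res s.1 x * P.res s.2 (y s.1)) := by
  obtain ⟨i, j⟩ := s
  -- Inserting a factor `1` at `i` gives one scalar per argument, as `MultilinearMap.map_smul_univ`
  -- requires.
  have h1 : (∏ r ∈ univ.erase i, P.aug (k r) (y r)) =
      ∏ r, if r = i then 1 else P.aug (k r) (y r) := by
    rw [← Finset.mul_prod_erase univ _ (mem_univ i), if_pos rfl, one_mul]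
    exact Finset.prod_congr rfl fun r hr => (if_neg (mem_erase.mp hr).1).symm
  have hL : ∀ r, ∑ j', (if blockEquiv k hk ⟨r, j'⟩ = blockEquiv k hk ⟨i, j⟩ then 1 else 0) =
      if r = i then 1 else 0 := by
    intro r
    by_cases hr : r = i
    · subst hr; simp
    · simp [hr]
  dsimp only
  rw [h1, res_mul]
  refine (plug_comp k hk _ _ (fun r => if r = i then 1 else 0) (by simp) hL _ _).trans ?_
  refine Eq.trans ?_ (MultilinearMap.map_smul_univ _ _ _)
  congr 1
  funext r
  -- The arity is `if r = i then 1 else 0`, inside a dependent type; it is replaced by a variable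
  -- `e` with an equation so that it can be substituted.
  have plug_off : ∀ (e : ℕ) (he : e = 0) (l : Fin (k r) → ℕ) (hl : ∀ j, l j = 0) (hs : ∑ j, l j = e)
      (ho : ∑ _j : Fin e, 1 = e) (a : P.Unary),
      P.plug l hs (y r) = P.aug (k r) (y r) • P.comp (fun _ => 1) ho (P.nUnit e) (fun _ => a) := by
    intro e he l hl hs ho a
    subst he
    rw [plug_zero l hl]
    congr 1
    exact (P.comp_zero_arity _ _ _ _ rfl).symm
  have plug_on : ∀ (e : ℕ) (he : e = 1) (l : Fin (k i) → ℕ) (hl : ∀ j', l j' = if j' = j then 1 else 0)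
      (hs : ∑ j, l j = e) (ho : ∑ _j : Fin e, 1 = e),
      P.plug l hs (y i) = P.comp (fun _ => 1) ho (P.nUnit e) (fun _ => P.res j (y i)) := by
    intro e he l hl hs ho
    subst he
    obtain rfl : l = fun j' => if j' = j then 1 else 0 := funext hl
    exact (P.one_comp (n := 1) ho _).symm
  by_cases hr : r = i
  · subst hr
    refine (plug_on _ (if_pos rfl) _ (by simp) _ (by simp)).trans ((one_smul K _).symm.trans ?_)
    exact congrArg (· • _) (if_pos rfl).symm
  · refine (plug_off _ (if_neg hr) _ (by simp [hr]) _ (by simp) (P.res j (y i))).trans ?_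
    exact congrArg (· • _) (if_neg hr).symm

theorem aug_res {n : ℕ} (i : Fin n) (x : P.obj n) : P.aug 1 (P.res i x) = P.aug n x := by
  refine (aug_comp _ _ _ _).trans ?_
  simp [aug_nUnit]

theorem res_act {n : ℕ} (σ : Equiv.Perm (Fin n)) (i : Fin n) (x : P.obj n) :
    P.res i (P.act σ x) = P.res (σ i) x := by
  have h := P.equivariance (m := 1) (fun r => if r = i then 1 else 0) (by simp) σ (fun _ => 1) x
    (fun r => P.nUnit (if r = i then 1 else 0))
  simp only [P.act_one] at h
  refine h.trans ?_
  -- The result has arity one, so the block permutation is the identity.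
  rw [Subsingleton.elim (blockPerm _ _ _ _) 1, P.act_one]
  refine P.comp_congr (funext fun r => ?_) _ _ x P.nUnit
  simp [Equiv.symm_apply_eq]

theorem aug_act {n : ℕ} (σ : Equiv.Perm (Fin n)) (x : P.obj n) :
    P.aug n (P.act σ x) = P.aug n x := by
  have h := P.equivariance (m := 0) (fun _ => 0) (by simp) σ (fun _ => 1) x
    (fun _ => P.unit₀)
  simp only [P.act_one] at h
  refine congrArg P.coord (h.trans ?_)
  rw [Subsingleton.elim (blockPerm _ _ _ _) 1, P.act_one]
  rfl

theorem res_one : P.res 0 P.one = 1 := plug_nUnit (n := 1) le_rfl _ _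

theorem res_self (x : P.obj 1) : P.res 0 x = x :=
  plug_one _ (fun i => by simp [Subsingleton.elim i 0]) _ x

end TwoUnitaryOperad

/-! ### Restrictions of the units `𝟙ₙ` -/

namespace TwoUnitaryOperad

variable {K : Type u} [Field K] {P : TwoUnitaryOperad K}

theorem res_unit₂ (i : Fin 2) : P.res i P.unit₂ = 1 := by
  match i with
  | 0 =>
    refine Eq.trans ?_ P.unit₂_right
    refine (P.comp_congr (k' := ![1, 0]) ?_ _ (by simp) P.unit₂ P.nUnit).trans ?_
    · funext i; fin_cases i <;> rfl
    · exact congrArg _ (funext fun | 0 => rfl | 1 => rfl)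
  | 1 =>
    refine Eq.trans ?_ P.unit₂_left
    refine (P.comp_congr (k' := ![0, 1]) ?_ _ (by simp) P.unit₂ P.nUnit).trans ?_
    · funext i; fin_cases i <;> rfl
    · exact congrArg _ (funext fun | 0 => rfl | 1 => rfl)

theorem res_comp₂_left {a b m : ℕ} (h : a + b = m) (x : P.obj a) (y : P.obj b) (j : Fin a) :
    P.res (blockEquiv ![a, b] (LinOperad.sum_pair h) ⟨0, j⟩) (P.comp₂ h P.unit₂ x y) =
      P.aug b y • P.res j x := by
  refine (res_comp _ _ _ _ _).trans ?_
  rw [show univ.erase (0 : Fin 2) = {1} from rfl, Finset.prod_singleton, res_unit₂, one_mul]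
  rfl

theorem res_comp₂_right {a b m : ℕ} (h : a + b = m) (x : P.obj a) (y : P.obj b) (j : Fin b) :
    P.res (blockEquiv ![a, b] (LinOperad.sum_pair h) ⟨1, j⟩) (P.comp₂ h P.unit₂ x y) =
      P.aug a x • P.res j y := by
  refine (res_comp _ _ _ _ _).trans ?_
  rw [show univ.erase (1 : Fin 2) = {0} from rfl, Finset.prod_singleton, res_unit₂, one_mul]
  rfl

theorem res_nUnit : ∀ (n : ℕ) (i : Fin n), P.res i (P.nUnit n) = 1
  | 1, i => by rw [Subsingleton.elim i 0]; exact res_one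
  | n + 2, i => by
    obtain ⟨⟨a, j⟩, rfl⟩ := (blockEquiv _ (LinOperad.sum_pair
      (show n + 1 + 1 = n + 2 from rfl))).surjective i
    match a, j with
    | 0, j =>
      refine (res_comp₂_left _ _ _ _).trans ?_
      rw [res_nUnit (n + 1) j, aug_one, one_smul]
    | 1, j =>
      refine (res_comp₂_right _ _ _ _).trans ?_
      rw [aug_nUnit, one_smul, Subsingleton.elim (α := Fin 1) j 0]
      exact res_one

theorem res_plug {n m : ℕ} (k : Fin n → ℕ) (h : ∑ i, k i = m) (s : Σ i, Fin (k i))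
    (x : P.obj n) : P.res (blockEquiv k h s) (P.plug k h x) = P.res s.1 x := by
  rw [plug_apply, res_comp]
  simp [aug_nUnit, res_nUnit]

/-! ### Operations that vanish when a unit is substituted -/

variable (P) in
/-- The operations which vanish after the substitution of `𝟙₀` in any nonempty set of inputs. -/
def IsCore {n : ℕ} (x : P.obj n) : Prop :=
  ∀ ⦃m : ℕ⦄ (l : Fin n → ℕ) (hl : ∑ i, l i = m), (∀ i, l i ≤ 1) → (∃ i, l i = 0) →
    P.plug l hl x = 0

/-- Induction on the arity: substituting `𝟙₀` in some inputs of `x` gives an operation of smaller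
arity whose restrictions are restrictions of `x`, hence zero. So `x` satisfies `IsCore`, and `hP`
applies from arity `2` on; in arity one `x` is its own restriction. -/
theorem eq_zero_of_res (hP : ∀ (k : ℕ), 2 ≤ k → ∀ x : P.obj k, P.IsCore x → x = 0) {n : ℕ}
    (hn : 1 ≤ n) {x : P.obj n} (hx : ∀ i, P.res i x = 0) : x = 0 := by
  induction n using Nat.strong_induction_on with
  | _ n ih =>
    rcases hn.lt_or_eq with hn | rfl
    · refine hP n hn x fun m l hl hl1 ⟨i, hi⟩ => ?_
      have hm : m < n := by
        rw [← hl]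
        calc ∑ i, l i < ∑ _i : Fin n, 1 :=
              Finset.sum_lt_sum (fun i _ => hl1 i) ⟨i, mem_univ i, by omega⟩
          _ = n := by simp
      rcases Nat.eq_zero_or_pos m with rfl | hm0
      -- With no inputs left the induction hypothesis is not available; the result is `ε(x) 𝟙₀`, and
      -- `ε(x) = ε(xᵢ) = 0`.
      · rw [plug_zero l (by simpa using hl), ← aug_res ⟨0, by omega⟩, hx]
        exact (congrArg (· • _) (map_zero (P.aug 1))).trans (zero_smul _ _)
      · refine ih m hm hm0 fun j => ?_
        obtain ⟨s, rfl⟩ := (blockEquiv l hl).surjective j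
        rw [res_plug, hx]
    · rw [← res_self x, hx]
      rfl

/-! ### Binomial lower bound for the dimensions -/

theorem plug_act {n m : ℕ} (l : Fin n → ℕ) (hl : ∑ i, l i = m) (σ : Equiv.Perm (Fin n))
    (x : P.obj n) :
    P.plug l hl (P.act σ x) = P.act (blockPerm l hl σ fun _ => 1)
      (P.plug (fun i => l (σ.symm i)) (sum_comp_symm l hl σ) x) := by
  have h := P.equivariance l hl σ (fun _ => 1) x fun r => P.nUnit (l r)
  simp only [P.act_one] at h
  exact h

theorem act_eq_zero {n : ℕ} (σ : Equiv.Perm (Fin n)) (x : P.obj n) :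
    P.act σ x = 0 ↔ x = 0 := by
  refine ⟨fun h => ?_, fun h => by rw [h, map_zero]⟩
  rw [← P.act_one x, ← mul_inv_cancel σ, P.act_mul, h, map_zero]

theorem exists_perm_block {k b n : ℕ} (h : k + b = n) (S : Finset (Fin n)) (hS : S.card = k) :
    ∃ σ : Equiv.Perm (Fin n), ∀ p, p ∈ S ↔
      ((blockEquiv ![k, b] (LinOperad.sum_pair h)).symm (σ p)).1 = 0 := by
  set e := blockEquiv ![k, b] (LinOperad.sum_pair h)
  have hc : Fintype.card {p // p ∈ S} = Fintype.card {p // (e.symm p).1 = 0} := by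
    rw [Fintype.card_coe, hS]
    have hf : Function.Bijective fun j : Fin k =>
        (⟨e ⟨0, j⟩, by rw [Equiv.symm_apply_apply]⟩ : {p // (e.symm p).1 = 0}) := by
      refine ⟨fun j j' hj => ?_, fun ⟨p, hp⟩ => ?_⟩
      · exact eq_of_heq (Sigma.mk.inj (e.injective (congrArg Subtype.val hj))).2
      · obtain ⟨⟨i, j⟩, rfl⟩ := e.surjective p
        obtain rfl : i = 0 := by rwa [Equiv.symm_apply_apply] at hp
        exact ⟨j, rfl⟩
    rw [← Fintype.card_of_bijective hf, Fintype.card_fin]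
  let g := Fintype.equivOfCardEq hc
  refine ⟨g.extendSubtype, fun p => ⟨fun hp => g.extendSubtype_mem p hp, fun hp => ?_⟩⟩
  by_contra hp'
  exact g.extendSubtype_not_mem p hp' hp

/-- Take `w = 𝟙₂ ∘ (x, 𝟙_b)`, permuted so that the inputs of `x` are those in `S`, and put `𝟙₀` in
all inputs outside `T`. If `T = S`, this leaves `𝟙₂ ∘ (x, 𝟙₀) = x` up to a permutation. If `T ≠ S`,
equality of cardinals yields an element of `S` outside `T`, so some input of `x` receives `𝟙₀` and
`x` is killed. -/
theorem exists_extension {k n : ℕ} (hkn : k ≤ n) {x : P.obj k} (hx : P.IsCore x) (hx0 : x ≠ 0)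
    (S : Finset (Fin n)) (hS : S.card = k) :
    ∃ w : P.obj n, ∀ (T : Finset (Fin n)) (hT : T.card = k),
      P.plug (fun p => if p ∈ T then 1 else 0) (by simpa using hT) w = 0 ↔ T ≠ S := by
  obtain ⟨b, rfl⟩ := Nat.exists_eq_add_of_le hkn
  obtain ⟨σ, hσ⟩ := exists_perm_block rfl S hS
  refine ⟨P.act σ (P.comp₂ rfl P.unit₂ x (P.nUnit b)), fun T hT => ?_⟩
  rw [plug_act, act_eq_zero]
  set l : Fin (k + b) → ℕ := fun i => if σ.symm i ∈ T then 1 else 0 with hl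
  have hl1 : ∀ i, l i ≤ 1 := fun i => by simp only [hl]; split_ifs <;> simp
  have hls : ∑ i, l i = k := sum_comp_symm (fun p => if p ∈ T then 1 else 0) (by simpa using hT) σ
  set e := blockEquiv ![k, b] (LinOperad.sum_pair rfl) with he
  have hmem : ∀ i j, σ.symm (e ⟨i, j⟩) ∈ S ↔ i = 0 := fun i j => by
    rw [hσ, Equiv.apply_symm_apply, Equiv.symm_apply_apply]
  have key : ∀ (L : Fin 2 → ℕ) (hL : ∑ i, L i = k) (h : ∀ i, ∑ j, l (e ⟨i, j⟩) = L i),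
      P.plug l hls (P.comp₂ rfl P.unit₂ x (P.nUnit b)) = P.comp L hL P.unit₂ fun i =>
        P.plug (fun j => l (e ⟨i, j⟩)) (h i) (P.pair x (P.nUnit b) i) := fun L hL h =>
    plug_comp _ _ l hls L hL h _ _
  refine ⟨fun h hTS => hx0 ?_, fun hTS => ?_⟩
  · subst hTS
    have hl' : ∀ i j, l (e ⟨i, j⟩) = if i = 0 then 1 else 0 := fun i j => by
      simp only [hl, hmem]
    have hs : ∀ i, ∑ j, l (e ⟨i, j⟩) = ![k, 0] i
      | 0 => (Finset.sum_congr rfl fun j _ => hl' 0 j).trans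
          (show ∑ _j : Fin k, 1 = k by simp)
      | 1 => Finset.sum_eq_zero fun j _ => hl' 1 j
    rw [← comp₂_unit₀_right x, ← h]
    refine Eq.trans ?_ (key ![k, 0] (by simp) hs).symm
    refine congrArg _ (funext fun i => ?_)
    match i with
    | 0 => exact (plug_one _ (hl' 0) _ x).symm
    | 1 =>
      refine Eq.trans ?_ (plug_zero _ (hl' 1) _ _).symm
      change P.unit₀ = P.aug b (P.nUnit b) • P.unit₀
      rw [aug_nUnit, one_smul]
  · refine (key (fun i => ∑ j, l (e ⟨i, j⟩)) ((sum_block _ _ l).trans hls)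
      fun _ => rfl).trans ?_
    refine MultilinearMap.map_coord_zero _ 0 ?_
    obtain ⟨s, hsS, hsT⟩ : ∃ s ∈ S, s ∉ T := by
      by_contra! hcon
      exact hTS (Finset.eq_of_subset_of_card_le hcon (by omega)).symm
    refine hx _ _ (fun j => hl1 _) ?_
    obtain ⟨⟨i, j⟩, hij⟩ := e.surjective (σ s)
    have hs : σ.symm (e ⟨i, j⟩) = s := by rw [hij, Equiv.symm_apply_apply]
    obtain rfl : i = 0 := (hmem i j).mp (by rwa [hs])
    exact ⟨j, by simp only [hl, hs, if_neg hsT]⟩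

/-- The substitutions indexed by the `k`-element sets `T` act on the extensions `w S` diagonally,
with nonzero diagonal entries, which forces linear independence. -/
theorem choose_le_finrank (hfin : P.LocallyFinite) {k : ℕ} {x : P.obj k} (hx : P.IsCore x)
    (hx0 : x ≠ 0) (n : ℕ) : n.choose k ≤ Module.finrank K (P.obj n) := by
  rcases lt_or_ge n k with hnk | hkn
  · rw [Nat.choose_eq_zero_of_lt hnk]; exact Nat.zero_le _
  have := hfin n
  choose w hw using fun S : {S : Finset (Fin n) // S.card = k} =>
    exists_extension hkn hx hx0 S.1 S.2
  have hli : LinearIndependent K w := by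
    rw [linearIndependent_iff']
    intro s g hg T hT
    have h1 := congrArg (P.plug (fun p => if p ∈ T.1 then 1 else 0) (by simpa using T.2)) hg
    rw [map_sum, map_zero, Finset.sum_eq_single_of_mem T hT, map_smul] at h1
    · exact (smul_eq_zero.mp h1).resolve_right fun h => (hw T T.1 T.2).mp h rfl
    · intro S _ hST
      rw [map_smul, (hw S T.1 T.2).mpr fun h => hST (Subtype.ext h).symm, smul_zero]
  have := hli.fintype_card_le_finrank
  rwa [Fintype.card_finset_len, Fintype.card_fin] at this

end TwoUnitaryOperad

/-! ## Growth -/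

theorem tendsto_add_div_log (a b : ℝ) :
    Filter.Tendsto (fun n : ℕ => ((a + b / Real.log n : ℝ) : EReal)) Filter.atTop
      (nhds (a : EReal)) := by
  refine (continuous_coe_real_ereal.tendsto a).comp ?_
  have h : Filter.Tendsto (fun n : ℕ => b / Real.log n) Filter.atTop (nhds 0) :=
    (Real.tendsto_log_atTop.comp tendsto_natCast_atTop_atTop).const_div_atTop b
  simpa using h.const_add a

theorem logb_mul_pow {n : ℕ} (hn : 2 ≤ n) {c : ℝ} (hc : 0 < c) (k : ℕ) :
    Real.logb n (c * n ^ k) = k + Real.log c / Real.log n := by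
  have hn0 : (0 : ℝ) < n := by positivity
  have hl : Real.log n ≠ 0 := (Real.log_pos (by exact_mod_cast hn)).ne'
  rw [Real.logb, Real.log_mul hc.ne' (by positivity), Real.log_pow]
  field_simp
  ring

namespace LinOperad

variable {K : Type u} [Field K] {P : LinOperad K}

theorem gkdim_le_of_sum_le {c : ℝ} (hc : 0 < c) (k : ℕ)
    (h : ∀ n : ℕ, 2 ≤ n →
      (∑ i ∈ range (n + 1), (Module.finrank K (P.obj i) : ℝ)) ≤ c * n ^ k)
    (hpos : 0 < Module.finrank K (P.obj 0)) : P.gkdim ≤ k := by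
  have ht := (tendsto_add_div_log k (Real.log c)).limsup_eq
  rw [gkdim]
  refine le_trans (Filter.limsup_le_limsup ?_) (ht.le.trans_eq (EReal.coe_natCast))
  filter_upwards [Filter.eventually_ge_atTop 2] with n hn
  rw [EReal.coe_le_coe_iff, ← logb_mul_pow hn hc]
  refine Real.logb_le_logb_of_le (by exact_mod_cast hn) ?_ (h n hn)
  -- Monotonicity of the logarithm needs a positive sum; the term of arity `0` provides it.
  refine Finset.sum_pos' (fun i _ => by positivity) ⟨0, by simp, by exact_mod_cast hpos⟩

theorem le_gkdim_of_le_sum {c : ℝ} (hc : 0 < c) (k N : ℕ)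
    (h : ∀ n : ℕ, N ≤ n →
      c * n ^ k ≤ ∑ i ∈ range (n + 1), (Module.finrank K (P.obj i) : ℝ)) : k ≤ P.gkdim := by
  have ht := (tendsto_add_div_log k (Real.log c)).limsup_eq
  rw [gkdim]
  rw [EReal.coe_natCast] at ht
  refine le_trans ht.ge (Filter.limsup_le_limsup ?_)
  filter_upwards [Filter.eventually_ge_atTop 2, Filter.eventually_ge_atTop N] with n hn hN
  rw [EReal.coe_le_coe_iff, ← logb_mul_pow hn hc]
  exact Real.logb_le_logb_of_le (by exact_mod_cast hn) (by positivity) (h n hN)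

theorem le_gkdim_of_choose_le {k : ℕ} (h : ∀ n, n.choose k ≤ Module.finrank K (P.obj n)) :
    ((k + 1 : ℕ) : EReal) ≤ P.gkdim := by
  -- The sum of the `i.choose k` is `(n + 1).choose (k + 1)`, at least `(n + 1 - k) ^ (k + 1) / (k +
  -- 1)!`; for `n ≥ 2 * k` the base is at least `n / 2`, whence the constant.
  refine le_gkdim_of_le_sum (c := ((2 : ℝ) ^ (k + 1) * (k + 1).factorial)⁻¹) (by positivity)
    (k + 1) (2 * k) fun n hn => ?_
  have h1 : ((n + 1).choose (k + 1) : ℝ) ≤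
      ∑ i ∈ range (n + 1), (Module.finrank K (P.obj i) : ℝ) := by
    rw [← Nat.sum_Icc_choose]
    push_cast
    refine (Finset.sum_le_sum fun i _ => (by exact_mod_cast h i :
      (i.choose k : ℝ) ≤ Module.finrank K (P.obj i))).trans
      (Finset.sum_le_sum_of_subset_of_nonneg (fun i hi => ?_) fun i _ _ => by positivity)
    rw [Finset.mem_Icc] at hi
    rw [Finset.mem_range]
    omega
  refine le_trans ?_ h1
  have h2 : ((n + 1 - (k + 1) + 1 : ℕ) : ℝ) ^ (k + 1) ≤
      (k + 1).factorial * (n + 1).choose (k + 1) := by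
    have := Nat.pow_sub_le_descFactorial (n + 1) (k + 1)
    rw [Nat.descFactorial_eq_factorial_mul_choose] at this
    have h3 : n + 1 + 1 - (k + 1) = n + 1 - (k + 1) + 1 := by omega
    rw [h3] at this
    exact_mod_cast this
  have h4 : (n : ℝ) ≤ 2 * ((n + 1 - (k + 1) + 1 : ℕ) : ℝ) := by
    have : n ≤ 2 * (n + 1 - (k + 1) + 1) := by omega
    exact_mod_cast this
  rw [inv_mul_le_iff₀ (by positivity), mul_assoc]
  calc (n : ℝ) ^ (k + 1) ≤ (2 * ((n + 1 - (k + 1) + 1 : ℕ) : ℝ)) ^ (k + 1) := by gcongr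
    _ = 2 ^ (k + 1) * ((n + 1 - (k + 1) + 1 : ℕ) : ℝ) ^ (k + 1) := mul_pow _ _ _
    _ ≤ _ := by gcongr

end LinOperad

/-! ### Consequences of the growth bound -/

namespace TwoUnitaryOperad

variable {K : Type u} [Field K] {P : TwoUnitaryOperad K}

theorem IsCore.eq_zero (hP : gkdimLETwo K P) {k : ℕ} (hk : 2 ≤ k) {x : P.obj k}
    (hx : P.IsCore x) : x = 0 := by
  by_contra hx0
  have h := (LinOperad.le_gkdim_of_choose_le (choose_le_finrank hP.1 hx hx0)).trans hP.2
  have : ((k + 1 : ℕ) : EReal) ≤ ((2 : ℕ) : EReal) := by exact_mod_cast h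
  rw [Nat.cast_le] at this
  omega

/-- Operations of an operad of GK-dimension at most `2` are determined by their restrictions. -/
theorem ext_of_res (hP : gkdimLETwo K P) {n : ℕ} {x y : P.obj n} (h0 : P.aug n x = P.aug n y)
    (h : ∀ i, P.res i x = P.res i y) : x = y := by
  rw [← sub_eq_zero]
  rcases Nat.eq_zero_or_pos n with rfl | hn
  -- In arity `0` there are no restrictions; the operation is its own augmentation times `𝟙₀`.
  · have : P.plug (m := 0) (fun _ => 0) (by simp) (x - y) = 0 := by
      rw [plug_zero _ (fun _ => rfl), map_sub, h0, sub_self, zero_smul]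
    rwa [plug_one _ (fun i => i.elim0)] at this
  · exact eq_zero_of_res (fun k hk x hx => hx.eq_zero hP hk) hn fun i => by
      rw [map_sub, h, sub_self]

end TwoUnitaryOperad

/-! ## The operads `D_B` -/

namespace FinNonUnitalAlg

variable {K : Type u} [Field K] {B : FinNonUnitalAlg K}

theorem hat_one {n : ℕ} (p : Fin n) : hat (B := B) ((1, 0) : B.DObj n) p = 1 := by
  ext <;> simp [hat]

theorem dComp_one {n m : ℕ} (k : Fin n → ℕ) (h : ∑ i, k i = m) :
    B.dComp k h (1, 0) (fun _ => (1, 0)) = (1, 0) := by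
  refine dObj_ext (by simp [dComp]) fun p => ?_
  obtain ⟨s, rfl⟩ := (blockEquiv k h).surjective p
  rw [hat_dComp, hat_one, hat_one, hat_one]
  simp

theorem dOperad_comp₂_one {a b m : ℕ} (h : a + b = m) :
    B.dOperad.comp₂ h (1, 0) ((1, 0) : B.DObj a) ((1, 0) : B.DObj b) = ((1, 0) : B.DObj m) := by
  refine Eq.trans ?_ (dComp_one ![a, b] (LinOperad.sum_pair h))
  exact congrArg (B.dComp ![a, b] (LinOperad.sum_pair h) (1, 0))
    (funext fun | 0 => rfl | 1 => rfl)

theorem dOperad_nUnit : ∀ n, B.dOperad.nUnit n = ((1, 0) : B.DObj n)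
  | 0 => rfl
  | 1 => rfl
  | n + 2 => by
    rw [TwoUnitaryOperad.nUnit, dOperad_nUnit (n + 1)]
    exact dOperad_comp₂_one _

theorem dOperad_isTwoA : TwoUnitaryOperad.isTwoA K B.dOperad :=
  (dOperad_comp₂_one (a := 2) (b := 1) rfl).trans
    (dOperad_comp₂_one (a := 1) (b := 2) rfl).symm

theorem dOperad_plug {n m : ℕ} (k : Fin n → ℕ) (h : ∑ i, k i = m) (x : B.DObj n) :
    B.dOperad.plug k h x = B.dComp k h x fun _ => (1, 0) :=
  congrArg (B.dComp k h x) (funext fun _ => dOperad_nUnit _)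

theorem dOperad_aug {n : ℕ} (x : B.DObj n) : B.dOperad.aug n x = x.1 := by
  apply TwoUnitaryOperad.aug_eq_of_plug
  rw [dOperad_plug]
  refine Prod.ext ?_ (Subsingleton.elim (α := Fin 0 → B.carrier) _ _)
  change x.1 * ∏ _r, (1 : K) = x.1 * 1
  simp

theorem dOperad_res {n : ℕ} (i : Fin n) (x : B.DObj n) :
    B.dOperad.res i x = ((x.1, fun _ => x.2 i) : B.DObj 1) := by
  refine (dOperad_plug _ _ x).trans (dObj_ext (by simp [dComp]) fun p => ?_)
  obtain ⟨⟨r, j⟩, rfl⟩ :=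
    (blockEquiv (fun r => if r = i then 1 else 0) (show _ = 1 by simp)).surjective p
  rw [hat_dComp, hat_one]
  have hr : r = i := by
    by_contra hr
    rw [if_neg hr] at j
    exact j.elim0
  subst hr
  simp [hat]

theorem finrank_dObj (n : ℕ) :
    Module.finrank K (B.DObj n) = 1 + n * Module.finrank K B.carrier := by
  rw [Module.finrank_prod, Module.finrank_self, Module.finrank_pi_fintype]
  simp

theorem dOperad_gkdimLETwo : TwoUnitaryOperad.gkdimLETwo K B.dOperad := by
  refine ⟨fun n => inferInstanceAs (Module.Finite K (B.DObj n)), ?_⟩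
  have hfr : ∀ i, Module.finrank K (B.dOperad.obj i) = 1 + i * Module.finrank K B.carrier :=
    finrank_dObj
  -- With `d = dim B`, the sum is at most `(n + 1) * (1 + n * d) ≤ 2 * n * (n * (1 + d))`.
  refine LinOperad.gkdim_le_of_sum_le (c := 2 * (1 + Module.finrank K B.carrier))
    (by positivity) 2 (fun n hn => ?_) (by rw [hfr]; omega)
  simp only [hfr]
  set d := Module.finrank K B.carrier
  have h1 : ∑ i ∈ range (n + 1), (1 + i * d) ≤ 2 * (1 + d) * n ^ 2 := by
    calc ∑ i ∈ range (n + 1), (1 + i * d) ≤ ∑ _i ∈ range (n + 1), (1 + n * d) :=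
          Finset.sum_le_sum fun i hi => by
            have : i ≤ n := by rw [Finset.mem_range] at hi; omega
            gcongr
      _ = (n + 1) * (1 + n * d) := by simp
      _ ≤ (2 * n) * (n * (1 + d)) := by
          gcongr
          · omega
          · rw [mul_add, mul_one]; omega
      _ = 2 * (1 + d) * n ^ 2 := by ring
  exact_mod_cast h1

end FinNonUnitalAlg

/-! ## Morphisms -/

namespace TwoUnitaryOperad

variable {K : Type u} [Field K] {P Q : TwoUnitaryOperad K}

theorem Hom.map_comp₂ (f : Hom P Q) {a b m : ℕ} (h : a + b = m) (t : P.obj 2) (x : P.obj a)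
    (y : P.obj b) :
    f.map m (P.comp₂ h t x y) = Q.comp₂ h (f.map 2 t) (f.map a x) (f.map b y) :=
  (f.map_comp _ _ _ _).trans <| congrArg _ (funext fun | 0 => rfl | 1 => rfl)

theorem Hom.map_nUnit (f : Hom P Q) : ∀ n, f.map n (P.nUnit n) = Q.nUnit n
  | 0 => f.map_unit₀
  | 1 => f.map_one
  | n + 2 => by rw [nUnit, nUnit, f.map_comp₂, f.map_nUnit (n + 1), f.map_unit₂, f.map_one]

theorem Hom.map_plug (f : Hom P Q) {n m : ℕ} (k : Fin n → ℕ) (h : ∑ i, k i = m) (x : P.obj n) :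
    f.map m (P.plug k h x) = Q.plug k h (f.map n x) :=
  (f.map_comp _ _ _ _).trans <| congrArg _ (funext fun _ => f.map_nUnit _)

theorem Hom.aug_map (f : Hom P Q) {n : ℕ} (x : P.obj n) : Q.aug n (f.map n x) = P.aug n x := by
  apply aug_eq_of_plug
  rw [← f.map_plug, plug_zero _ fun _ => rfl, map_smul, f.map_unit₀]

theorem Hom.res_map (f : Hom P Q) {n : ℕ} (i : Fin n) (x : P.obj n) :
    Q.res i (f.map n x) = f.map 1 (P.res i x) :=
  (f.map_plug _ _ x).symm

/-- A morphism all of whose components are bijective is an isomorphism. -/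
noncomputable def isoOfBijective (f : Hom P Q) (h : ∀ n, Function.Bijective (f.map n)) :
    P ≅ Q :=
  let e : ∀ n, P.obj n ≃ₗ[K] Q.obj n := fun n => LinearEquiv.ofBijective (f.map n) (h n)
  have he : ∀ n x, f.map n x = e n x := fun _ _ => rfl
  { hom := f
    inv :=
      { map := fun n => (e n).symm
        map_act := fun {n} σ x => (h n).1 <| by
          rw [f.map_act]; simp [he]
        map_one := (h 1).1 <| by rw [f.map_one]; simp [he]
        map_comp := fun {n m} k hk x y => (h m).1 <| by
          rw [f.map_comp]; simp [he]
        map_unit₀ := (h 0).1 <| by rw [f.map_unit₀]; simp [he]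
        map_unit₂ := (h 2).1 <| by rw [f.map_unit₂]; simp [he] }
    hom_inv_id := Hom.ext (funext fun n => LinearMap.ext fun x => (e n).symm_apply_apply x)
    inv_hom_id := Hom.ext (funext fun n => LinearMap.ext fun x => (e n).apply_symm_apply x) }

end TwoUnitaryOperad

/-! ## The unitization of the augmentation ideal -/

namespace FinAugAlg

variable {K : Type u} [Field K]

/-- The canonical morphism from the unitization of the augmentation ideal. -/
noncomputable def ofUnitization (A : FinAugAlg K) : Unitization K A.ideal →ₐ[K] A.carrier :=
  Unitization.lift (NonUnitalSubalgebraClass.subtype A.ideal)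

theorem ofUnitization_inl (A : FinAugAlg K) (c : K) :
    ofUnitization A (Unitization.inl c) = algebraMap K A.carrier c :=
  (ofUnitization A).commutes c

theorem ofUnitization_inr (A : FinAugAlg K) (b : A.ideal) :
    ofUnitization A (b : Unitization K A.ideal) = b := by
  simp [ofUnitization]

theorem ofUnitization_injective (A : FinAugAlg K) : Function.Injective (ofUnitization A) := by
  rw [injective_iff_map_eq_zero]
  intro x hx
  induction x with
  | inl_add_inr c b =>
    have h1 : algebraMap K A.carrier c + b = 0 := by simpa [ofUnitization] using hx
    have h2 := congrArg A.aug h1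
    have hb : A.aug (b : A.carrier) = 0 := b.2
    rw [map_add, hb, map_zero, add_zero, AlgHom.commutes] at h2
    obtain rfl : c = 0 := h2
    rw [map_zero, zero_add] at h1
    obtain rfl : b = 0 := Subtype.ext h1
    simp

end FinAugAlg

/-! ## Operads of GK-dimension at most two -/

namespace TwoUnitaryOperad

open FinAugAlg

variable {K : Type u} [Field K] {P : TwoUnitaryOperad K}

theorem res_sub_mem (h : P.LocallyFinite) {n : ℕ} (x : P.obj n) (i : Fin n) :
    P.res i x - P.aug n x • (1 : P.Unary) ∈ (P.unaryAlg h).ideal := by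
  change Unary.augHom P (P.res i x - P.aug n x • (1 : P.Unary)) = 0
  rw [map_sub, map_smul, map_one, smul_eq_mul, mul_one, sub_eq_zero]
  exact aug_res i x

/-- The linear map `x ↦ ε(x) 𝟙ₙ + ∑ᵢ (xᵢ - ε(x)) δᵢ`, where `xᵢ` is the restriction of `x` to the
`i`-th input. -/
noncomputable def toDLin (h : P.LocallyFinite) (n : ℕ) :
    P.obj n →ₗ[K]
      FinNonUnitalAlg.DObj ((FinAugAlg.augIdeal K).obj (P.unaryAlg h)) n where
  toFun x := (P.aug n x, fun i => ⟨P.res i x - P.aug n x • (1 : P.Unary), res_sub_mem h x i⟩)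
  map_add' x y := by
    refine Prod.ext (map_add _ _ _) (funext fun i => Subtype.ext ?_)
    change P.res i (x + y) - P.aug n (x + y) • (1 : P.Unary) =
      (P.res i x - P.aug n x • (1 : P.Unary)) + (P.res i y - P.aug n y • (1 : P.Unary))
    rw [map_add, map_add, add_smul]
    abel
  map_smul' c x := by
    refine Prod.ext (map_smul _ _ _) (funext fun i => Subtype.ext ?_)
    change P.res i (c • x) - P.aug n (c • x) • (1 : P.Unary) =
      c • (P.res i x - P.aug n x • (1 : P.Unary))
    rw [map_smul, map_smul, smul_sub, smul_assoc]

/-- Identifies `hat` with the restrictions, so that `hat_dComp` and `res_comp` become the same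
formula in `A`. -/
theorem ofUnitization_hat (h : P.LocallyFinite) {n : ℕ} (x : P.obj n) (p : Fin n) :
    ofUnitization (P.unaryAlg h) (FinNonUnitalAlg.hat (toDLin h n x) p) = P.res p x := by
  have : ofUnitization (P.unaryAlg h) (FinNonUnitalAlg.hat (toDLin h n x) p) =
      algebraMap K P.Unary (P.aug n x) + (P.res p x - P.aug n x • (1 : P.Unary)) := by
    refine (map_add (ofUnitization _) _ _).trans ?_
    exact congrArg₂ (· + ·) (ofUnitization_inl (P.unaryAlg h) _)
      (ofUnitization_inr (P.unaryAlg h) _)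
  rw [this, Algebra.algebraMap_eq_smul_one, add_sub_cancel]

theorem ofUnitization_hat_one (A : FinAugAlg K) {n : ℕ} (p : Fin n) :
    ofUnitization A (FinNonUnitalAlg.hat
      ((1, 0) : FinNonUnitalAlg.DObj ((FinAugAlg.augIdeal K).obj A) n) p) = 1 :=
  (congrArg (ofUnitization A) (FinNonUnitalAlg.hat_one p)).trans (map_one (ofUnitization A))

theorem toDLin_eq (h : P.LocallyFinite) {n : ℕ} (x : P.obj n)
    (y : FinNonUnitalAlg.DObj ((FinAugAlg.augIdeal K).obj (P.unaryAlg h)) n)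
    (h0 : P.aug n x = y.1)
    (hres : ∀ p, P.res p x = ofUnitization (P.unaryAlg h) (FinNonUnitalAlg.hat y p)) :
    toDLin h n x = y :=
  FinNonUnitalAlg.dObj_ext h0 fun p => ofUnitization_injective _ <| by
    rw [ofUnitization_hat, hres]

/-- The canonical morphism from a locally finite 2-unitary operad to the operad `D_A`, where `A` is
the algebra of unary operations. -/
noncomputable def toD (h : P.LocallyFinite) :
    Hom P ((operadD K).obj (P.unaryAlg h)) where
  map n := toDLin h n
  map_act {n} σ x := toDLin_eq h _ _ (aug_act σ x) fun p => by
    rw [res_act]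
    exact (ofUnitization_hat h x (σ p)).symm
  map_one := toDLin_eq h _ _ aug_one fun p => by
    rw [Subsingleton.elim p 0, res_one]
    exact (ofUnitization_hat_one (P.unaryAlg h) _).symm
  map_comp {n m} k hk x y := toDLin_eq h _ _ (aug_comp k hk x y) fun p => by
    obtain ⟨s, rfl⟩ := (blockEquiv k hk).surjective p
    rw [res_comp]
    refine Eq.symm ((congrArg _ (FinNonUnitalAlg.hat_dComp k hk _ _ s)).trans ?_)
    refine (map_smul (ofUnitization (P.unaryAlg h)) _ _).trans (congrArg _ ?_)
    exact (map_mul (ofUnitization (P.unaryAlg h)) _ _).trans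
      (congrArg₂ (· * ·) (ofUnitization_hat h _ _) (ofUnitization_hat h _ _))
  map_unit₀ := toDLin_eq h _ _ aug_unit₀ fun p => p.elim0
  map_unit₂ := toDLin_eq h _ _ aug_unit₂ fun p => by
    rw [res_unit₂]
    exact (ofUnitization_hat_one (P.unaryAlg h) _).symm

/-- The witness is `c 𝟙ₙ + ∑ᵢ dᵢ` with `dᵢ = 𝟙ₙ ∘ (𝟙, …, bᵢ, …, 𝟙)`, which plays the role of `bᵢ
δᵢ`: its restriction to the `i`-th input is `bᵢ`, and the others carry the factor `ε(bᵢ) = 0`. -/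
theorem exists_aug_res (n : ℕ) (c : K) (b : Fin n → P.Unary) (hb : ∀ i, P.aug 1 (b i) = 0) :
    ∃ x : P.obj n, P.aug n x = c ∧ ∀ i, P.res i x = c • (1 : P.Unary) + b i := by
  have hn : ∑ _i : Fin n, 1 = n := by simp
  let y : ∀ i : Fin n, ∀ j : Fin n, P.obj 1 := fun i j => if j = i then b i else P.one
  let d : Fin n → P.obj n := fun i => P.comp (fun _ => 1) hn (P.nUnit n) (y i)
  have hd : ∀ i, P.aug n (d i) = 0 := fun i => by
    rw [aug_comp, Finset.prod_eq_zero (mem_univ i), mul_zero]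
    exact (congrArg (P.aug 1) (if_pos rfl)).trans (hb i)
  have hr : ∀ i j, P.res j (d i) = if j = i then b i else 0 := fun i j => by
    obtain ⟨⟨r, s⟩, hs⟩ := (blockEquiv (fun _ => 1) hn).surjective j
    -- All blocks have size one, so the block number is the place.
    have hrj : r = j := by
      rw [← hs]
      apply Fin.ext
      rw [blockEquiv_val, ← Finset.sum_filter]
      simp [Finset.filter_gt_eq_Iio]
    subst hrj
    have h1 := res_comp (fun _ => 1) hn (P.nUnit n) (y i) ⟨r, s⟩
    rw [hs] at h1
    refine h1.trans ?_
    dsimp only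
    rw [res_nUnit, one_mul, Subsingleton.elim s 0, res_self]
    by_cases hri : r = i
    · subst hri
      have hy : y r r = b r := if_pos rfl
      rw [if_pos rfl, Finset.prod_eq_one, hy]
      · exact one_smul K (b r)
      · intro j hj
        exact (congrArg (P.aug 1) (if_neg (mem_erase.mp hj).1)).trans aug_one
    · rw [if_neg hri, Finset.prod_eq_zero (mem_erase.mpr ⟨Ne.symm hri, mem_univ i⟩)]
      · exact zero_smul K (y i r : P.Unary)
      · exact (congrArg (P.aug 1) (if_pos rfl)).trans (hb i)
  refine ⟨c • P.nUnit n + ∑ i, d i, ?_, fun i => ?_⟩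
  · rw [map_add, map_smul, map_sum, aug_nUnit, Finset.sum_eq_zero fun i _ => hd i]
    simp
  · rw [map_add, map_smul, map_sum, res_nUnit]
    simp only [hr]
    simp

/-- The growth bound enters through injectivity alone. -/
theorem toD_bijective (hP : gkdimLETwo K P) (n : ℕ) :
    Function.Bijective (toDLin hP.1 n) := by
  refine ⟨fun x y hxy => ext_of_res hP (congrArg Prod.fst hxy) fun i => ?_, fun y => ?_⟩
  · rw [← ofUnitization_hat hP.1, hxy, ofUnitization_hat]
  · obtain ⟨x, hx0, hx⟩ := exists_aug_res (P := P) n y.1 (fun i => (y.2 i).1) fun i => (y.2 i).2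
    refine ⟨x, Prod.ext hx0 (funext fun i => Subtype.ext ?_)⟩
    change P.res i x - P.aug n x • (1 : P.Unary) = _
    rw [hx, hx0, add_sub_cancel_left]

/-- A 2-unitary operad of GK-dimension at most `2` is the operad `D_A` of its algebra `A` of unary
operations. -/
noncomputable def isoD (hP : gkdimLETwo K P) :
    P ≅ (operadD K).obj (P.unaryAlg hP.1) :=
  isoOfBijective (toD hP.1) (toD_bijective hP)

theorem isTwoA_of_iso {Q : TwoUnitaryOperad K} (e : P ≅ Q) (hQ : isTwoA K Q) : isTwoA K P := by
  let f : Hom P Q := e.hom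
  let g : Hom Q P := e.inv
  have hgf : ∀ x, g.map 3 (f.map 3 x) = x := fun x =>
    congrArg (fun h : Hom P P => h.map 3 x) e.hom_inv_id
  refine (Function.LeftInverse.injective hgf) ?_
  rw [f.map_comp₂, f.map_comp₂, f.map_unit₂, f.map_one]
  exact hQ

end TwoUnitaryOperad

/-! ## The functor from non-unital algebras to operads -/

namespace FinNonUnitalAlg

variable {K : Type u} [Field K]

variable (K) in
/-- The functor `B ↦ D_B`. -/
def dFunctor : FinNonUnitalAlg K ⥤ TwoUnitaryOperad K where
  obj B := B.dOperad
  map f := dMap f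

/-- The morphism of algebras induced by a morphism `D_B → D_{B'}`. -/
def ofDHom {B B' : FinNonUnitalAlg K} (g : TwoUnitaryOperad.Hom B.dOperad B'.dOperad) :
    B.carrier →ₙₐ[K] B'.carrier :=
  -- Morphisms preserve `ε`, so the image of `b δ₁` has no `𝟙₁` component.
  have hg : ∀ b : B.carrier, (g.map 1 ((0, fun _ => b) : B.DObj 1) : B'.DObj 1) =
      (0, fun _ => (g.map 1 ((0, fun _ => b) : B.DObj 1) : B'.DObj 1).2 0) := fun b => by
    refine Prod.ext ?_ (funext fun i => by rw [Subsingleton.elim i 0])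
    have := g.aug_map ((0, fun _ => b) : B.DObj 1)
    exact (dOperad_aug _).symm.trans (this.trans (dOperad_aug _))
  { toFun b := (g.map 1 ((0, fun _ => b) : B.DObj 1) : B'.DObj 1).2 0
    map_smul' c b := by
      have h : ((0, fun _ => c • b) : B.DObj 1) = c • ((0, fun _ => b) : B.DObj 1) :=
        Prod.ext (by simp) rfl
      exact congrArg (fun x : B'.DObj 1 => x.2 0) ((congrArg (g.map 1) h).trans (map_smul _ _ _))
    map_zero' := congrArg (fun x : B'.DObj 1 => x.2 0) (map_zero (g.map 1))
    map_add' b c := by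
      have h : ((0, fun _ => b + c) : B.DObj 1) =
          ((0, fun _ => b) : B.DObj 1) + ((0, fun _ => c) : B.DObj 1) :=
        Prod.ext (by simp) rfl
      exact congrArg (fun x : B'.DObj 1 => x.2 0) ((congrArg (g.map 1) h).trans (map_add _ _ _))
    map_mul' b c := by
      have hmul : ∀ {C : FinNonUnitalAlg K} (b c : C.carrier),
          C.dComp (n := 1) (m := 1) (fun _ => 1) rfl (0, fun _ => b) (fun _ => (0, fun _ => c)) =
            (0, fun _ => b * c) := fun {C} b c => by
        refine Prod.ext (by simp [dComp]) (funext fun p => ?_)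
        have he : ∀ i : Fin 1, univ.erase i = ∅ := by decide
        simp only [dComp, dCoord, he]
        simp
      have h1 := g.map_comp (n := 1) (m := 1) (fun _ => 1) rfl ((0, fun _ => b) : B.DObj 1)
        (fun _ => ((0, fun _ => c) : B.DObj 1))
      have h2 : g.map 1 ((0, fun _ => b * c) : B.DObj 1) =
          B'.dComp (n := 1) (m := 1) (fun _ => 1) rfl (g.map 1 ((0, fun _ => b) : B.DObj 1))
            (fun _ => g.map 1 ((0, fun _ => c) : B.DObj 1)) :=
        (congrArg (g.map 1) (hmul b c).symm).trans h1
      rw [hg b, hg c, hmul] at h2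
      exact congrArg (fun x : B'.DObj 1 => x.2 0) h2 }

instance : (dFunctor K).Faithful where
  map_injective {B B'} f g h := by
    refine NonUnitalAlgHom.ext fun b => ?_
    have h1 := congrArg (fun h : TwoUnitaryOperad.Hom B.dOperad B'.dOperad =>
      h.map 1 ((0, fun _ => b) : B.DObj 1)) h
    exact congrArg (fun x : B'.DObj 1 => x.2 0) h1

/-- An element of `D_{B'}` is determined by its augmentation and its restrictions; `g` commutes with
both, and the restrictions lie in arity one, where `g` fixes `𝟙` and acts on `b δ₁` through
`ofDHom`. -/
instance : (dFunctor K).Full where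
  map_surjective {B B'} g := by
    let g' : TwoUnitaryOperad.Hom B.dOperad B'.dOperad := g
    refine ⟨ofDHom g', TwoUnitaryOperad.Hom.ext (funext fun n => LinearMap.ext fun x => ?_)⟩
    change dMapLin (ofDHom g') n x = (g'.map n x : B'.DObj n)
    refine Prod.ext ?_ (funext fun i => ?_)
    · have := g'.aug_map x
      exact ((dOperad_aug _).symm.trans (this.trans (dOperad_aug x))).symm
    · have h1 := g'.res_map i x
      replace h1 := (dOperad_res i _).symm.trans (h1.trans (congrArg (g'.map 1) (dOperad_res i x)))
      have h2 : ((x.1, fun _ => x.2 i) : B.DObj 1) =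
          x.1 • ((1, 0) : B.DObj 1) + ((0, fun _ => x.2 i) : B.DObj 1) :=
        Prod.ext (by simp) (funext fun _ => by simp)
      have h3 : g'.map 1 ((1, 0) : B.DObj 1) = ((1, 0) : B'.DObj 1) := g'.map_one
      have h4 := h1.trans ((congrArg (g'.map 1) h2).trans
        ((map_add _ _ _).trans (congrArg (· + _) ((map_smul _ _ _).trans (congrArg _ h3)))))
      have h5 := congrArg (fun x : B'.DObj 1 => x.2 0) h4
      refine Eq.symm (h5.trans ?_)
      change x.1 • (0 : B'.carrier) + _ = _
      rw [smul_zero, zero_add]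
      rfl

end FinNonUnitalAlg

/-! ## Augmented algebras and non-unital algebras -/

namespace FinAugAlg

variable {K : Type u} [Field K]

theorem sub_aug_mem (A : FinAugAlg K) (a : A.carrier) :
    a - algebraMap K A.carrier (A.aug a) ∈ A.ideal := by
  change A.aug _ = 0
  rw [map_sub, AlgHom.commutes]
  exact sub_self _

/-- Every `a` is the scalar `ε(a)`, which morphisms fix, plus the element `a - ε(a)` of the ideal.
-/
instance : (augIdeal K).Faithful where
  map_injective {A B} f g h := by
    refine Hom.ext (AlgHom.ext fun a => ?_)
    have h1 : idealMap f = idealMap g := h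
    have h2 := congrArg Subtype.val (DFunLike.congr_fun h1 ⟨_, sub_aug_mem A a⟩)
    have h3 : f.toAlgHom (a - algebraMap K A.carrier (A.aug a)) =
      g.toAlgHom (a - algebraMap K A.carrier (A.aug a)) := h2
    rwa [map_sub, map_sub, AlgHom.commutes, AlgHom.commutes, sub_left_inj] at h3

/-- The isomorphism of an augmented algebra with the unitization of its augmentation ideal. -/
noncomputable def unitizationEquiv (A : FinAugAlg K) : Unitization K A.ideal ≃ₐ[K] A.carrier :=
  AlgEquiv.ofBijective (ofUnitization A)
    ⟨ofUnitization_injective A, fun a =>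
      ⟨Unitization.inl (A.aug a) + ((⟨_, sub_aug_mem A a⟩ : A.ideal) : Unitization K A.ideal), by
        rw [map_add, ofUnitization_inl, ofUnitization_inr, add_sub_cancel]⟩⟩

theorem unitizationEquiv_inr (A : FinAugAlg K) (b : A.ideal) :
    A.unitizationEquiv (b : Unitization K A.ideal) = b :=
  ofUnitization_inr A b

theorem aug_unitizationEquiv (A : FinAugAlg K) (x : Unitization K A.ideal) :
    A.aug (A.unitizationEquiv x) = x.fst := by
  induction x with
  | inl_add_inr c b =>
    have hb : A.aug (b : A.carrier) = 0 := b.2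
    rw [map_add, map_add, unitizationEquiv_inr, hb]
    have : A.unitizationEquiv (Unitization.inl c) = algebraMap K A.carrier c :=
      A.unitizationEquiv.commutes c
    rw [this, AlgHom.commutes]
    simp

instance : (augIdeal K).Full where
  map_surjective {A B} f := by
    let f' : A.ideal →ₙₐ[K] B.ideal := f
    -- The universal property of the unitization extends `f'`; the extension is carried over to `A`
    -- by `unitizationEquiv`.
    let F : A.carrier →ₐ[K] B.carrier :=
      (Unitization.lift ((NonUnitalSubalgebraClass.subtype B.ideal).comp f')).comp
        A.unitizationEquiv.symm.toAlgHom
    have hF : ∀ x, F (A.unitizationEquiv x) =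
        Unitization.lift ((NonUnitalSubalgebraClass.subtype B.ideal).comp f') x := fun x => by
      simp [F]
    refine ⟨⟨F, AlgHom.ext fun a => ?_⟩, NonUnitalAlgHom.ext fun b => Subtype.ext ?_⟩
    · obtain ⟨x, rfl⟩ := A.unitizationEquiv.surjective a
      rw [AlgHom.comp_apply, hF, aug_unitizationEquiv]
      induction x with
      | inl_add_inr c b =>
        have hb : B.aug (f' b : B.carrier) = 0 := (f' b).2
        simp [hb]
    · let b' : A.ideal := b
      change F (b' : A.carrier) = (f' b' : B.carrier)
      rw [← unitizationEquiv_inr, hF]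
      simp

instance (B : FinNonUnitalAlg K) : Module.Finite K (Unitization K B.carrier) :=
  Module.Finite.equiv (Unitization.linearEquiv K K B.carrier).symm

/-- The unitization of a non-unital algebra as an augmented algebra. -/
abbrev ofNonUnital (B : FinNonUnitalAlg K) : FinAugAlg K where
  carrier := Unitization K B.carrier
  aug := Unitization.fstHom K B.carrier

instance : (augIdeal K).EssSurj where
  mem_essImage B := by
    let f : B.carrier →ₙₐ[K] (ofNonUnital B).ideal :=
      { toFun b := ⟨(b : Unitization K B.carrier), Unitization.fst_inr K b⟩
        map_smul' c b := Subtype.ext (Unitization.inr_smul K c b)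
        map_zero' := Subtype.ext (Unitization.inr_zero K)
        map_add' b c := Subtype.ext (Unitization.inr_add K b c)
        map_mul' b c := Subtype.ext (Unitization.inr_mul K b c) }
    let g : (ofNonUnital B).ideal →ₙₐ[K] B.carrier :=
      { toFun x := x.1.snd
        map_smul' c x := Unitization.snd_smul c x.1
        map_zero' := Unitization.snd_zero
        map_add' x y := Unitization.snd_add x.1 y.1
        map_mul' x y := by
          have hx : x.1.fst = 0 := x.2
          have hy : y.1.fst = 0 := y.2
          change (x.1 * y.1).snd = _
          rw [Unitization.snd_mul, hx, hy]
          simp }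
    refine ⟨ofNonUnital B, ⟨⟨g, f, ?_, ?_⟩⟩⟩
    · refine NonUnitalAlgHom.ext fun x => Subtype.ext (Unitization.ext ?_ rfl)
      exact (show x.1.fst = 0 from x.2).symm
    · exact NonUnitalAlgHom.ext fun _ => rfl

instance isEquivalence_augIdeal : (augIdeal K).IsEquivalence where

end FinAugAlg

/-! ### Assembly of the equivalences -/

theorem operadD_eq (K : Type u) [Field K] :
    operadD K = FinAugAlg.augIdeal K ⋙ FinNonUnitalAlg.dFunctor K := rfl

instance (K : Type u) [Field K] : (operadD K).Full := by
  rw [operadD_eq]; infer_instance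

instance (K : Type u) [Field K] : (operadD K).Faithful := by
  rw [operadD_eq]; infer_instance

/-- Serves both categories of operads: fullness and faithfulness are inherited from `operadD`, and
`isoD` gives essential surjectivity for any class of operads of GK-dimension at most `2` containing
all `D_A`. -/
theorem isEquivalence_lift_operadD {K : Type u} [Field K] {p : ObjectProperty (TwoUnitaryOperad K)}
    (hp : p ≤ TwoUnitaryOperad.gkdimLETwo K) (h : ∀ A, p ((operadD K).obj A)) :
    (p.lift (operadD K) h).IsEquivalence where
  essSurj := ⟨fun P =>
    ⟨_, ⟨p.isoMk (TwoUnitaryOperad.isoD (hp P.obj P.property)).symm⟩⟩⟩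

theorem operadD_gkdimLETwo {K : Type u} [Field K] (A : FinAugAlg K) :
    TwoUnitaryOperad.gkdimLETwo K ((operadD K).obj A) :=
  FinNonUnitalAlg.dOperad_gkdimLETwo

theorem operadD_isTwoA {K : Type u} [Field K] (A : FinAugAlg K) :
    TwoUnitaryOperad.isTwoA K ((operadD K).obj A) :=
  FinNonUnitalAlg.dOperad_isTwoA

theorem isTwoA_of_gkdimLETwo {K : Type u} [Field K] {P : TwoUnitaryOperad K}
    (hP : TwoUnitaryOperad.gkdimLETwo K P) : TwoUnitaryOperad.isTwoA K P :=
  TwoUnitaryOperad.isTwoA_of_iso (TwoUnitaryOperad.isoD hP) (operadD_isTwoA _)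

theorem theorem0p6 (K : Type u) [Field K] :
    -- augmented algebras and non-unital algebras
    (FinAugAlg.augIdeal K).IsEquivalence ∧
    -- augmented algebras and 2-unitary operads of GK-dimension at most 2
    (∃ h : ∀ A, TwoUnitaryOperad.gkdimLETwo K ((operadD K).obj A),
      ((TwoUnitaryOperad.gkdimLETwo K).lift (operadD K) h).IsEquivalence) ∧
    -- augmented algebras and 2a-unitary operads of GK-dimension at most 2
    (∃ h : ∀ A, (TwoUnitaryOperad.gkdimLETwo K ⊓ TwoUnitaryOperad.isTwoA K) ((operadD K).obj A),
      ((TwoUnitaryOperad.gkdimLETwo K ⊓ TwoUnitaryOperad.isTwoA K).lift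
        (operadD K) h).IsEquivalence) ∧
    -- 2a-unitary and 2-unitary operads of GK-dimension at most 2
    (ObjectProperty.ιOfLE (inf_le_left : TwoUnitaryOperad.gkdimLETwo K ⊓
      TwoUnitaryOperad.isTwoA K ≤ TwoUnitaryOperad.gkdimLETwo K)).IsEquivalence ∧
    -- each of these operads is 2a-unitary and of the form `D_A`
    (∀ P : TwoUnitaryOperad K, TwoUnitaryOperad.gkdimLETwo K P →
      TwoUnitaryOperad.isTwoA K P ∧
        ∃ A : FinAugAlg K, Nonempty (P ≅ (operadD K).obj A)) ∧
    -- the dimensions of `D_A`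
    (∀ (A : FinAugAlg K) (n : ℕ),
      Module.Finite K (((operadD K).obj A).obj n) ∧
        Module.finrank K (((operadD K).obj A).obj n) =
          1 + n * Module.finrank K A.ideal) := by
  refine ⟨inferInstance, ⟨operadD_gkdimLETwo, isEquivalence_lift_operadD le_rfl _⟩,
    ⟨fun A => ⟨operadD_gkdimLETwo A, operadD_isTwoA A⟩,
      isEquivalence_lift_operadD inf_le_left _⟩, ?_,
    fun P hP => ⟨isTwoA_of_gkdimLETwo hP, _, ⟨TwoUnitaryOperad.isoD hP⟩⟩,
    fun A n => ⟨(operadD_gkdimLETwo A).1 n, FinNonUnitalAlg.finrank_dObj n⟩⟩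
  -- The inclusion is surjective on objects, since each operad of the larger category is already
  -- 2a-unitary.
  exact
    { essSurj := ⟨fun P =>
        ⟨⟨P.obj, P.property, isTwoA_of_gkdimLETwo P.property⟩, ⟨Iso.refl _⟩⟩⟩ }
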